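/- Let $n,m\ge 1$ and let $\mathcal A_{n,m}=S^1\times[0,1]$ be an annulus with $n$ marked points on its outer boundary circle and $m$ marked points on its inner boundary circle. Consider curves in $\mathcal A_{n,m}$ that join two (possibly equal) marked points, run through the interior of the annulus, do not cross themselves (apart from a possible coincidence of the two endpoints), and are not homotopic with fixed endpoints to a curve in the boundary that contains no marked point other than its endpoints. An *arc* is a class of such curves up to homotopy in the annulus with fixed endpoints and up to reversal of direction (equivalently, an isotopy class). Two arcs are *noncrossing* if they have representatives that do not meet except possibly at their endpoints, and a *triangulation* of $\mathcal A_{n,m}$ is a maximal collection of pairwise noncrossing arcs. Two triangulations are *inner equivalent* if one is carried to the other by a finite sequence of $2\pi$ Dehn twists, in either direction, of the inner boundary circle. Then the number of inner equivalence classes of triangulations of $\mathcal A_{n,m}$ is $$T(\mathcal A_{n,m})=n\sum_{i=0}^{m-1}(i+1)\,C_i\,C_{n+m-i-1},$$ where $C_k=\frac{1}{k+1}\binom{2k}{k}$ is the $k$-th Catalan number. In particular the number of classes is finite. -/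

import Mathlib

/-- The standard annulus `S¹ × [0,1]`, with `S¹ = ℝ / ℤ`. The circle at height `1` is the outer
boundary component, the circle at height `0` is the inner one. -/
abbrev Annulus : Type := UnitAddCircle × unitInterval

namespace Annulus

/-- The points of the two boundary circles. -/
def IsBoundary (p : Annulus) : Prop := p.2 = 0 ∨ p.2 = 1

/-- The marked points: those of `A` on the outer circle, those of `B` on the inner circle. -/
def IsMarked (A B : Finset UnitAddCircle) (p : Annulus) : Prop :=
  (p.2 = 1 ∧ p.1 ∈ A) ∨ (p.2 = 0 ∧ p.1 ∈ B)

/-- Parametrized curves in the annulus. -/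
abbrev Curve : Type := C(unitInterval, Annulus)

/-- Homotopy of curves in the annulus, keeping both endpoints fixed. -/
def Homotopic (γ δ : Curve) : Prop := ContinuousMap.HomotopicRel γ δ {0, 1}

/-- The curve traversed backwards. -/
def Curve.reverse (γ : Curve) : Curve :=
  γ.comp ⟨unitInterval.symm, unitInterval.continuous_symm⟩

/-- `γ` is homotopic to a piece of a boundary component between two consecutive marked points,
that is, to a curve in the boundary that does not meet a marked point except at its ends. (The
curve `δ` may turn back, so a contractible loop has this property as well. When a boundary
circle carries only one marked point, so has the loop once around that circle.) -/
def IsBoundaryParallel (A B : Finset UnitAddCircle) (γ : Curve) : Prop :=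
  ∃ δ : Curve, Homotopic γ δ ∧ (∀ s, IsBoundary (δ s)) ∧
    ∀ s ∈ Set.Ioo (0 : unitInterval) 1, ¬ IsMarked A B (δ s)

/-- The curves that represent arcs: they join marked points, run through the interior of the
annulus, do not cross themselves (the two endpoints may agree), and are not homotopic to a
piece of the boundary between consecutive marked points. -/
structure IsArcCurve (A B : Finset UnitAddCircle) (γ : Curve) : Prop where
  marked_zero : IsMarked A B (γ 0)
  marked_one : IsMarked A B (γ 1)
  interior : ∀ s ∈ Set.Ioo (0 : unitInterval) 1, ¬ IsBoundary (γ s)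
  simple : Set.InjOn γ (Set.Ioo (0 : unitInterval) 1)
  essential : ¬ IsBoundaryParallel A B γ

/-- The type of all curves that represent arcs. -/
def ArcCurve (A B : Finset UnitAddCircle) : Type := {γ : Curve // IsArcCurve A B γ}

/-- Two curves represent the same arc if they are homotopic with fixed endpoints, after
reversing one of them if necessary (arcs are not oriented). -/
def SameArc (γ δ : Curve) : Prop := Homotopic γ δ ∨ Homotopic γ δ.reverse

theorem reverse_reverse (γ : Curve) : γ.reverse.reverse = γ := by
  ext s <;> simp [Curve.reverse]

theorem Homotopic.reverse {γ δ : Curve} (h : Homotopic γ δ) :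
    Homotopic γ.reverse δ.reverse := by
  obtain ⟨H⟩ := h
  refine ⟨⟨⟨⟨fun p => H (p.1, unitInterval.symm p.2), by fun_prop⟩, ?_, ?_⟩, ?_⟩⟩
  · intro s; simp [Curve.reverse]
  · intro s; simp [Curve.reverse]
  · intro t s hs
    have hs' : unitInterval.symm s ∈ ({0, 1} : Set unitInterval) := by
      rcases hs with rfl | hs
      · simp
      · rw [Set.mem_singleton_iff] at hs; simp [hs]
    exact H.eq_fst t hs'

theorem sameArc_equivalence : Equivalence SameArc where
  refl γ := Or.inl (ContinuousMap.HomotopicRel.refl γ)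
  symm := by
    rintro γ δ (h | h)
    · exact Or.inl (ContinuousMap.HomotopicRel.symm h)
    · refine Or.inr ?_
      have := Homotopic.reverse h
      rw [reverse_reverse] at this
      exact ContinuousMap.HomotopicRel.symm this
  trans := by
    rintro γ δ ε (h | h) (k | k)
    · exact Or.inl (ContinuousMap.HomotopicRel.trans h k)
    · exact Or.inr (ContinuousMap.HomotopicRel.trans h k)
    · exact Or.inr (ContinuousMap.HomotopicRel.trans h (Homotopic.reverse k))
    · refine Or.inl ?_
      have := Homotopic.reverse k
      rw [reverse_reverse] at this
      exact ContinuousMap.HomotopicRel.trans h this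

instance arcSetoid (A B : Finset UnitAddCircle) : Setoid (ArcCurve A B) where
  r γ δ := SameArc γ.1 δ.1
  iseqv := ⟨fun γ => sameArc_equivalence.refl γ.1, fun h => sameArc_equivalence.symm h,
    fun h k => sameArc_equivalence.trans h k⟩

/-- The arcs of the annulus with marked points `A` and `B`. -/
def Arc (A B : Finset UnitAddCircle) : Type := Quotient (arcSetoid A B)

/-- The arc represented by a curve. -/
def ArcCurve.toArc {A B : Finset UnitAddCircle} (γ : ArcCurve A B) : Arc A B := Quotient.mk _ γ

/-- Two arcs do not cross if they have representatives that meet at most at their endpoints. -/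
def NonCrossing {A B : Finset UnitAddCircle} (a b : Arc A B) : Prop :=
  ∃ γ δ : ArcCurve A B, γ.toArc = a ∧ δ.toArc = b ∧
    ∀ s ∈ Set.Ioo (0 : unitInterval) 1, ∀ t ∈ Set.Ioo (0 : unitInterval) 1, γ.1 s ≠ δ.1 t

/-- A triangulation is a maximal set of pairwise noncrossing arcs. -/
def IsTriangulation {A B : Finset UnitAddCircle} (T : Set (Arc A B)) : Prop :=
  Maximal (fun S : Set (Arc A B) => S.Pairwise NonCrossing) T

/-- The set of triangulations, as a type. -/
def Triangulation (A B : Finset UnitAddCircle) : Type := {T : Set (Arc A B) // IsTriangulation T}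

/-- The `2π` Dehn twist of the inner boundary component: the circle at height `t` is rotated by
`1 - t` full turns, so that the outer circle is at rest and the inner one makes a full turn. -/
noncomputable def dehnTwist : Annulus ≃ₜ Annulus where
  toFun p := (p.1 + ((1 - (p.2 : ℝ) : ℝ) : UnitAddCircle), p.2)
  invFun p := (p.1 - ((1 - (p.2 : ℝ) : ℝ) : UnitAddCircle), p.2)
  left_inv p := by ext <;> simp
  right_inv p := by ext <;> simp
  continuous_toFun := by
    have h : Continuous (fun x : ℝ => (x : UnitAddCircle)) := AddCircle.continuous_mk' 1
    exact (continuous_fst.add (h.comp (by fun_prop))).prodMk continuous_snd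
  continuous_invFun := by
    have h : Continuous (fun x : ℝ => (x : UnitAddCircle)) := AddCircle.continuous_mk' 1
    exact (continuous_fst.sub (h.comp (by fun_prop))).prodMk continuous_snd

/-- `h` fixes the boundary of the annulus pointwise. -/
def FixesBoundary (h : Annulus ≃ₜ Annulus) : Prop := ∀ p, IsBoundary p → h p = p

theorem fixesBoundary_dehnTwist : FixesBoundary dehnTwist := by
  rintro ⟨x, t⟩ (h | h)
  · have h' : t = 0 := h
    subst h'
    have : ((1 : ℝ) : UnitAddCircle) = 0 := AddCircle.coe_period 1
    simp [dehnTwist, this]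
  · have h' : t = 1 := h
    subst h'
    simp [dehnTwist]

theorem FixesBoundary.symm {h : Annulus ≃ₜ Annulus} (hh : FixesBoundary h) :
    FixesBoundary h.symm := fun p hp => by
  rw [Homeomorph.symm_apply_eq, hh p hp]

theorem FixesBoundary.isBoundary_iff {h : Annulus ≃ₜ Annulus} (hh : FixesBoundary h)
    (p : Annulus) : IsBoundary (h p) ↔ IsBoundary p := by
  refine ⟨fun hp => ?_, fun hp => by rwa [hh p hp]⟩
  have := hh.symm (h p) hp
  rw [Homeomorph.symm_apply_apply] at this
  rwa [← this] at hp

theorem IsMarked.isBoundary {A B : Finset UnitAddCircle} {p : Annulus} (h : IsMarked A B p) :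
    IsBoundary p := by
  rcases h with h | h
  · exact Or.inr h.1
  · exact Or.inl h.1

/-- The image of a curve under a homeomorphism of the annulus. -/
def Curve.map (h : Annulus ≃ₜ Annulus) (γ : Curve) : Curve := (h : C(Annulus, Annulus)).comp γ

theorem Homotopic.map (h : Annulus ≃ₜ Annulus) {γ δ : Curve} (k : Homotopic γ δ) :
    Homotopic (γ.map h) (δ.map h) :=
  ContinuousMap.HomotopicRel.comp_continuousMap k (h : C(Annulus, Annulus))

theorem symm_map_map (h : Annulus ≃ₜ Annulus) (γ : Curve) : (γ.map h).map h.symm = γ := by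
  apply ContinuousMap.ext
  intro s
  exact h.symm_apply_apply (γ s)

theorem map_symm_map (h : Annulus ≃ₜ Annulus) (γ : Curve) : (γ.map h.symm).map h = γ := by
  apply ContinuousMap.ext
  intro s
  exact h.apply_symm_apply (γ s)

theorem IsArcCurve.map {A B : Finset UnitAddCircle} {h : Annulus ≃ₜ Annulus}
    (hh : FixesBoundary h) {γ : Curve} (hγ : IsArcCurve A B γ) : IsArcCurve A B (γ.map h) where
  marked_zero := by
    have := hγ.marked_zero
    change IsMarked A B (h (γ 0))
    rwa [hh _ this.isBoundary]
  marked_one := by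
    have := hγ.marked_one
    change IsMarked A B (h (γ 1))
    rwa [hh _ this.isBoundary]
  interior s hs := fun hb => hγ.interior s hs ((hh.isBoundary_iff (γ s)).1 hb)
  simple := fun s hs t ht e => hγ.simple hs ht (h.injective e)
  essential := by
    rintro ⟨δ, hδ, hb, hm⟩
    have hδ' := Homotopic.map h.symm hδ
    rw [symm_map_map] at hδ'
    have e : δ.map h.symm = δ := by
      apply ContinuousMap.ext
      intro s
      exact hh.symm _ (hb s)
    rw [e] at hδ'
    exact hγ.essential ⟨δ, hδ', hb, hm⟩

/-- The image of a representing curve under a homeomorphism that fixes the boundary. -/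
def ArcCurve.map {A B : Finset UnitAddCircle} (h : Annulus ≃ₜ Annulus) (hh : FixesBoundary h)
    (γ : ArcCurve A B) : ArcCurve A B := ⟨γ.1.map h, γ.2.map hh⟩

/-- The image of an arc under a homeomorphism that fixes the boundary. -/
def Arc.map {A B : Finset UnitAddCircle} (h : Annulus ≃ₜ Annulus) (hh : FixesBoundary h) :
    Arc A B → Arc A B :=
  Quotient.map (ArcCurve.map h hh) fun _ _ k => k.imp (Homotopic.map h) (Homotopic.map h)

/-- The `2π` Dehn twist of the inner boundary component, as a permutation of the arcs. -/
noncomputable def Arc.twist (A B : Finset UnitAddCircle) : Equiv.Perm (Arc A B) where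
  toFun := Arc.map dehnTwist fixesBoundary_dehnTwist
  invFun := Arc.map dehnTwist.symm fixesBoundary_dehnTwist.symm
  left_inv a := by
    induction a using Quotient.inductionOn with
    | h γ => exact congrArg (Quotient.mk _) (Subtype.ext (symm_map_map dehnTwist γ.1))
  right_inv a := by
    induction a using Quotient.inductionOn with
    | h γ => exact congrArg (Quotient.mk _) (Subtype.ext (map_symm_map dehnTwist γ.1))

/-- Two triangulations are inner equivalent if a sequence of `2π` Dehn twists (in either
direction) of the inner boundary component takes one to the other. -/
def InnerEquivalent {A B : Finset UnitAddCircle} (T T' : Triangulation A B) : Prop :=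
  ∃ k : ℤ, ((Arc.twist A B) ^ k) '' T.1 = T'.1

instance innerSetoid (A B : Finset UnitAddCircle) : Setoid (Triangulation A B) where
  r := InnerEquivalent
  iseqv := by
    refine ⟨fun T => ⟨0, by simp⟩, ?_, ?_⟩
    · rintro T T' ⟨k, hk⟩
      refine ⟨-k, ?_⟩
      rw [← hk, ← Set.image_comp, ← Equiv.Perm.coe_mul, ← zpow_add]
      simp
    · rintro T T' T'' ⟨k, hk⟩ ⟨l, hl⟩
      refine ⟨l + k, ?_⟩
      rw [← hl, ← hk, ← Set.image_comp, ← Equiv.Perm.coe_mul, ← zpow_add]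

/-- The families, that is, the inner equivalence classes of triangulations. -/
def Family (A B : Finset UnitAddCircle) : Type := Quotient (innerSetoid A B)

end Annulus

/-! The universal cover of the annulus is a strip. Up to homotopy and reversal, an arc is determined
by the endpoints of one lift, that is, by a `Seg` satisfying `Adm`, up to deck translations. If the
endpoints of two lifts interleave on the boundary of the strip, the curves are forced to meet:
otherwise their difference would be a nowhere vanishing vector field on a square, and its angle
along the sides gives a contradiction. If no lifts interleave, explicit curves avoid each other
(`stdCurve_ne`). Triangulations therefore correspond to maximal families of segments without
`PeriodicCross` (`triangulationEquiv`), and a Dehn twist adds `m` to the labels of the inner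
endpoints.

For the count, fix the edge from `0` to `1` on the inner line. Among the inner arcs of a
triangulation that pass over this edge, together with the edge itself, let `(u, v)` be the
outermost. The triangle on its outer side has its apex `x` on the outer line (`Tri.exists_sides`),
and the triple `x, u, v` is unique (`Tri.sides_unique`). A twist combined with a deck translation
moves `x` by `n` and fixes `u` and `v`, so each class has exactly one member with `0 ≤ x < n`. This
gives the factor `n`. With `i = v - u - 1` there are `i + 1` intervals over the fixed edge, and `0 ≤
i < m`.

The triangle cuts the annulus into the polygon between `u` and `v`, with `i + 2` vertices, and a
polygon with `n + m - i + 1` vertices (`annulus_cut`). They are triangulated independently, in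
`catalan i` and `catalan (n + m - i - 1)` ways (`card_polygon_facets`). The resulting sum is
positive, so the equality of `Nat.card` also says that the set of classes is finite. -/

namespace Annulus

/-! ### Maximal noncrossing families -/

/-- `T` is a maximal family of pairwise noncrossing elements of `D`, in a form that presumes that
no element of `D` crosses itself. -/
def IsFacet {X : Type*} (D : Set X) (Cr : X → X → Prop) (T : Set X) : Prop :=
  ∀ p, p ∈ T ↔ p ∈ D ∧ ∀ q ∈ T, ¬ Cr p q

/-- The type of maximal noncrossing families. -/
abbrev Facet {X : Type*} (D : Set X) (Cr : X → X → Prop) : Type _ := {T : Set X // IsFacet D Cr T}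

/-- The situation in which a set `S` of sides cuts the elements of `D` (up to the equivalence
`r`) into two independent pieces `D₁` and `D₂`. -/
structure Cut {Y X₁ X₂ : Type*} (r : Setoid Y) (D : Set Y) (Cr : Y → Y → Prop) (S : Set Y)
    (D₁ : Set X₁) (Cr₁ : X₁ → X₁ → Prop) (D₂ : Set X₂) (Cr₂ : X₂ → X₂ → Prop)
    (f₁ : X₁ → Y) (f₂ : X₂ → Y) : Prop where
  cross_congr : ∀ a b c d, r a b → r c d → Cr a c → Cr b d
  mem_congr : ∀ a b, r a b → a ∈ D → b ∈ D
  symm : ∀ a b, Cr a b → Cr b a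
  irrefl : ∀ a ∈ D, ¬ Cr a a
  sides_mem : ∀ s ∈ S, s ∈ D
  sides : ∀ s ∈ S, ∀ t ∈ S, ¬ Cr s t
  mem₁ : ∀ x ∈ D₁, f₁ x ∈ D
  mem₂ : ∀ x ∈ D₂, f₂ x ∈ D
  cross₁ : ∀ x ∈ D₁, ∀ y ∈ D₁, (Cr (f₁ x) (f₁ y) ↔ Cr₁ x y)
  cross₂ : ∀ x ∈ D₂, ∀ y ∈ D₂, (Cr (f₂ x) (f₂ y) ↔ Cr₂ x y)
  cross₁₂ : ∀ x ∈ D₁, ∀ y ∈ D₂, ¬ Cr (f₁ x) (f₂ y)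
  cross₁s : ∀ x ∈ D₁, ∀ s ∈ S, ¬ Cr (f₁ x) s
  cross₂s : ∀ x ∈ D₂, ∀ s ∈ S, ¬ Cr (f₂ x) s
  inj₁ : ∀ x ∈ D₁, ∀ y ∈ D₁, r (f₁ x) (f₁ y) → x = y
  inj₂ : ∀ x ∈ D₂, ∀ y ∈ D₂, r (f₂ x) (f₂ y) → x = y
  ne₁₂ : ∀ x ∈ D₁, ∀ y ∈ D₂, ¬ r (f₁ x) (f₂ y)
  ne₁s : ∀ x ∈ D₁, ∀ s ∈ S, ¬ r (f₁ x) s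
  ne₂s : ∀ x ∈ D₂, ∀ s ∈ S, ¬ r (f₂ x) s
  cover : ∀ y ∈ D, (∀ s ∈ S, ¬ Cr y s) →
    (∃ s ∈ S, r y s) ∨ (∃ x ∈ D₁, r y (f₁ x)) ∨ ∃ x ∈ D₂, r y (f₂ x)

namespace Cut

variable {Y X₁ X₂ : Type*} {r : Setoid Y} {D : Set Y} {Cr : Y → Y → Prop} {S : Set Y}
    {D₁ : Set X₁} {Cr₁ : X₁ → X₁ → Prop} {D₂ : Set X₂} {Cr₂ : X₂ → X₂ → Prop}
    {f₁ : X₁ → Y} {f₂ : X₂ → Y}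

theorem mem_of_rel (h : Cut r D Cr S D₁ Cr₁ D₂ Cr₂ f₁ f₂) {T : Set Y} (hT : IsFacet D Cr T)
    {a b : Y} (hab : r a b) (ha : a ∈ T) : b ∈ T :=
  (hT b).2 ⟨h.mem_congr a b hab ((hT a).1 ha).1, fun q hq hc =>
    ((hT a).1 ha).2 q hq (h.cross_congr b a q q (r.symm' hab) (r.refl' q) hc)⟩

theorem cover_of_mem (h : Cut r D Cr S D₁ Cr₁ D₂ Cr₂ f₁ f₂) {T : Set Y} (hT : IsFacet D Cr T)
    (hS : S ⊆ T) {y : Y} (hy : y ∈ T) :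
    (∃ s ∈ S, r y s) ∨ (∃ x ∈ D₁, r y (f₁ x)) ∨ ∃ x ∈ D₂, r y (f₂ x) :=
  h.cover y ((hT y).1 hy).1 fun s hs => ((hT y).1 hy).2 s (hS hs)

/-- By `cover`, a member of `T` is a side or comes from one of the two pieces. Only members from the
first piece can cross `f₁ x`, so maximality in `Y` restricts to maximality in the piece. -/
theorem isFacet_left (h : Cut r D Cr S D₁ Cr₁ D₂ Cr₂ f₁ f₂) {T : Set Y} (hT : IsFacet D Cr T)
    (hS : S ⊆ T) : IsFacet D₁ Cr₁ {x | x ∈ D₁ ∧ f₁ x ∈ T} := by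
  intro x
  constructor
  · rintro ⟨hx, hxT⟩
    exact ⟨hx, fun y hy hc => ((hT _).1 hxT).2 _ hy.2 ((h.cross₁ x hx y hy.1).2 hc)⟩
  · rintro ⟨hx, hxc⟩
    refine ⟨hx, (hT _).2 ⟨h.mem₁ x hx, fun q hq hc => ?_⟩⟩
    rcases h.cover_of_mem hT hS hq with ⟨s, hs, hr⟩ | ⟨y, hy, hr⟩ | ⟨y, hy, hr⟩
    · exact h.cross₁s x hx s hs (h.cross_congr _ _ _ _ (r.refl' _) hr hc)
    · exact hxc y ⟨hy, h.mem_of_rel hT hr hq⟩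
        ((h.cross₁ x hx y hy).1 (h.cross_congr _ _ _ _ (r.refl' _) hr hc))
    · exact h.cross₁₂ x hx y hy (h.cross_congr _ _ _ _ (r.refl' _) hr hc)

protected theorem swap (h : Cut r D Cr S D₁ Cr₁ D₂ Cr₂ f₁ f₂) :
    Cut r D Cr S D₂ Cr₂ D₁ Cr₁ f₂ f₁ where
  __ := h
  mem₁ := h.mem₂
  mem₂ := h.mem₁
  cross₁ := h.cross₂
  cross₂ := h.cross₁
  cross₁₂ x hx y hy hc := h.cross₁₂ y hy x hx (h.symm _ _ hc)
  cross₁s := h.cross₂s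
  cross₂s := h.cross₁s
  inj₁ := h.inj₂
  inj₂ := h.inj₁
  ne₁₂ x hx y hy hc := h.ne₁₂ y hy x hx (r.symm' hc)
  ne₁s := h.ne₂s
  ne₂s := h.ne₁s
  cover y hy hs := (h.cover y hy hs).imp id Or.symm

/-- The family glued from families in the two pieces. -/
def glue (r : Setoid Y) (S : Set Y) (f₁ : X₁ → Y) (f₂ : X₂ → Y) (T₁ : Set X₁) (T₂ : Set X₂) :
    Set Y :=
  {y | (∃ s ∈ S, r y s) ∨ (∃ x ∈ T₁, r y (f₁ x)) ∨ ∃ x ∈ T₂, r y (f₂ x)}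

/-- Elements from different pieces, and sides, never cross, so gluing creates no crossing.
Conversely, an element that crosses nothing in the glued family misses the sides, hence lies in one
piece, where maximality applies. -/
theorem isFacet_glue (h : Cut r D Cr S D₁ Cr₁ D₂ Cr₂ f₁ f₂) {T₁ : Set X₁} {T₂ : Set X₂}
    (h₁ : IsFacet D₁ Cr₁ T₁) (h₂ : IsFacet D₂ Cr₂ T₂) :
    IsFacet D Cr (glue r S f₁ f₂ T₁ T₂) := by
  have m₁ : ∀ x ∈ T₁, x ∈ D₁ := fun x hx => ((h₁ x).1 hx).1
  have m₂ : ∀ x ∈ T₂, x ∈ D₂ := fun x hx => ((h₂ x).1 hx).1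
  intro p
  constructor
  · intro hp
    refine ⟨?_, fun q hq hc => ?_⟩
    · rcases hp with ⟨s, hs, hr⟩ | ⟨x, hx, hr⟩ | ⟨x, hx, hr⟩
      · exact h.mem_congr _ _ (r.symm' hr) (h.sides_mem s hs)
      · exact h.mem_congr _ _ (r.symm' hr) (h.mem₁ x (m₁ x hx))
      · exact h.mem_congr _ _ (r.symm' hr) (h.mem₂ x (m₂ x hx))
    · rcases hp with ⟨s, hs, hr⟩ | ⟨x, hx, hr⟩ | ⟨x, hx, hr⟩ <;>
      rcases hq with ⟨t, ht, kr⟩ | ⟨y, hy, kr⟩ | ⟨y, hy, kr⟩ <;>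
      have hc' := h.cross_congr _ _ _ _ hr kr hc
      · exact h.sides s hs t ht hc'
      · exact h.cross₁s y (m₁ y hy) s hs (h.symm _ _ hc')
      · exact h.cross₂s y (m₂ y hy) s hs (h.symm _ _ hc')
      · exact h.cross₁s x (m₁ x hx) t ht hc'
      · exact ((h₁ x).1 hx).2 y hy ((h.cross₁ x (m₁ x hx) y (m₁ y hy)).1 hc')
      · exact h.cross₁₂ x (m₁ x hx) y (m₂ y hy) hc'
      · exact h.cross₂s x (m₂ x hx) t ht hc'
      · exact h.cross₁₂ y (m₁ y hy) x (m₂ x hx) (h.symm _ _ hc')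
      · exact ((h₂ x).1 hx).2 y hy ((h.cross₂ x (m₂ x hx) y (m₂ y hy)).1 hc')
  · rintro ⟨hp, hpc⟩
    rcases h.cover p hp fun s hs => hpc s (Or.inl ⟨s, hs, r.refl' s⟩) with
      ⟨s, hs, hr⟩ | ⟨x, hx, hr⟩ | ⟨x, hx, hr⟩
    · exact Or.inl ⟨s, hs, hr⟩
    · refine Or.inr (Or.inl ⟨x, (h₁ x).2 ⟨hx, fun y hy hc => ?_⟩, hr⟩)
      exact hpc (f₁ y) (Or.inr (Or.inl ⟨y, hy, r.refl' _⟩))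
        (h.cross_congr _ _ _ _ (r.symm' hr) (r.refl' _)
          ((h.cross₁ x hx y (m₁ y hy)).2 hc))
    · refine Or.inr (Or.inr ⟨x, (h₂ x).2 ⟨hx, fun y hy hc => ?_⟩, hr⟩)
      exact hpc (f₂ y) (Or.inr (Or.inr ⟨y, hy, r.refl' _⟩))
        (h.cross_congr _ _ _ _ (r.symm' hr) (r.refl' _)
          ((h.cross₂ x hx y (m₂ y hy)).2 hc))

theorem glue_swap (T₁ : Set X₁) (T₂ : Set X₂) :
    glue r S f₁ f₂ T₁ T₂ = glue r S f₂ f₁ T₂ T₁ := by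
  ext y
  exact or_congr_right or_comm

theorem glue_left (h : Cut r D Cr S D₁ Cr₁ D₂ Cr₂ f₁ f₂) {T₁ : Set X₁} {T₂ : Set X₂}
    (h₁ : IsFacet D₁ Cr₁ T₁) (h₂ : IsFacet D₂ Cr₂ T₂) :
    {x | x ∈ D₁ ∧ f₁ x ∈ glue r S f₁ f₂ T₁ T₂} = T₁ := by
  ext x
  constructor
  · rintro ⟨hx, ⟨s, hs, hr⟩ | ⟨y, hy, hr⟩ | ⟨y, hy, hr⟩⟩
    · exact (h.ne₁s x hx s hs hr).elim
    · rwa [h.inj₁ x hx y ((h₁ y).1 hy).1 hr]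
    · exact (h.ne₁₂ x hx y ((h₂ y).1 hy).1 hr).elim
  · intro hx
    exact ⟨((h₁ x).1 hx).1, Or.inr (Or.inl ⟨x, hx, r.refl' _⟩)⟩

/-- Maximal noncrossing families that contain the sides are pairs of such families of the two
pieces. -/
def equiv (h : Cut r D Cr S D₁ Cr₁ D₂ Cr₂ f₁ f₂) :
    {T : Set Y // IsFacet D Cr T ∧ S ⊆ T} ≃ Facet D₁ Cr₁ × Facet D₂ Cr₂ where
  toFun T := (⟨_, h.isFacet_left T.2.1 T.2.2⟩, ⟨_, h.swap.isFacet_left T.2.1 T.2.2⟩)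
  invFun P := ⟨glue r S f₁ f₂ P.1.1 P.2.1, h.isFacet_glue P.1.2 P.2.2,
    fun s hs => Or.inl ⟨s, hs, r.refl' s⟩⟩
  left_inv := by
    rintro ⟨T, hT, hS⟩
    refine Subtype.ext (Set.ext fun y => ⟨?_, fun hy => ?_⟩)
    · rintro (⟨s, hs, hr⟩ | ⟨x, hx, hr⟩ | ⟨x, hx, hr⟩)
      · exact h.mem_of_rel hT (r.symm' hr) (hS hs)
      · exact h.mem_of_rel hT (r.symm' hr) hx.2
      · exact h.mem_of_rel hT (r.symm' hr) hx.2
    · rcases h.cover_of_mem hT hS hy with ⟨s, hs, hr⟩ | ⟨x, hx, hr⟩ | ⟨x, hx, hr⟩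
      · exact Or.inl ⟨s, hs, hr⟩
      · exact Or.inr (Or.inl ⟨x, ⟨hx, h.mem_of_rel hT hr hy⟩, hr⟩)
      · exact Or.inr (Or.inr ⟨x, ⟨hx, h.mem_of_rel hT hr hy⟩, hr⟩)
  right_inv := by
    rintro ⟨⟨T₁, h₁⟩, ⟨T₂, h₂⟩⟩
    refine Prod.ext (Subtype.ext (h.glue_left h₁ h₂)) (Subtype.ext ?_)
    change {x | x ∈ D₂ ∧ f₂ x ∈ glue r S f₁ f₂ T₁ T₂} = T₂
    rw [glue_swap]
    exact h.swap.glue_left h₂ h₁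

end Cut

/-- Counting by the value of a function. -/
theorem card_eq_sum_of_existsUnique {X ι : Type*} (s : Finset ι) (P : ι → X → Prop)
    (hP : ∀ x, ∃! i, i ∈ s ∧ P i x) (hpos : ∀ i ∈ s, Nat.card {x // P i x} ≠ 0) :
    Nat.card X = ∑ i ∈ s, Nat.card {x // P i x} := by
  -- `Nat.card` vanishes on infinite types, so a nonzero value certifies that the fibre is finite.
  have hfin : ∀ i : s, Finite {x // P i x} := fun i => Nat.finite_of_card_ne_zero (hpos i i.2)
  let e : X ≃ Σ i : s, {x // P i x} :=
    { toFun x := ⟨⟨(hP x).choose, (hP x).choose_spec.1.1⟩, x, (hP x).choose_spec.1.2⟩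
      invFun y := y.2.1
      left_inv x := rfl
      right_inv := by
        rintro ⟨⟨i, hi⟩, x, hx⟩
        have : i = (hP x).choose := (hP x).choose_spec.2 i ⟨hi, hx⟩
        subst this
        rfl }
  rw [Nat.card_congr e, Nat.card_sigma, Finset.sum_coe_sort s (fun i => Nat.card {x // P i x})]

/-! ### Triangulations of polygons -/

/-- Chords with endpoints in `ℤ` cross when their endpoints interleave. -/
def ChordCross (p q : ℤ × ℤ) : Prop :=
  (p.1 < q.1 ∧ q.1 < p.2 ∧ p.2 < q.2) ∨ (q.1 < p.1 ∧ p.1 < q.2 ∧ q.2 < p.2)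

/-- The diagonals of the polygon with vertices `i, i + 1, …, j`. -/
def diagonals (i j : ℤ) : Set (ℤ × ℤ) :=
  {p | i ≤ p.1 ∧ p.1 + 2 ≤ p.2 ∧ p.2 ≤ j ∧ ¬ (p.1 = i ∧ p.2 = j)}

/-- The sides of a triangle over the edge `(i, j)` that are diagonals. -/
def polygonSides (i j r : ℤ) : Set (ℤ × ℤ) :=
  {p | p ∈ diagonals i j ∧ (p = (i, r) ∨ p = (r, j))}

/-- A chord with `r` strictly between its ends crosses `(i, r)` unless it starts at `i`, and crosses
`(r, j)` unless it ends at `j`. As `(i, j)` itself is excluded, the remaining chords are sides or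
lie in one of the two smaller polygons. A side that is an edge of the polygon is no diagonal and is
omitted from `polygonSides`. -/
theorem polygon_cut {i j r : ℤ} (hi : i < r) (hj : r < j) :
    Cut ⊥ (diagonals i j) ChordCross (polygonSides i j r) (diagonals i r) ChordCross
      (diagonals r j) ChordCross id id := by
  constructor
  case cover =>
    rintro ⟨a, b⟩ hy hs
    have h1 : i + 2 ≤ r → ¬ ChordCross (a, b) (i, r) := fun h =>
      hs _ ⟨⟨le_rfl, h, hj.le, by simp; omega⟩, Or.inl rfl⟩
    have h2 : r + 2 ≤ j → ¬ ChordCross (a, b) (r, j) := fun h =>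
      hs _ ⟨⟨hi.le, h, le_rfl, by simp; omega⟩, Or.inr rfl⟩
    simp only [ChordCross, polygonSides, diagonals, Set.mem_ofPred_eq, Prod.exists, Setoid.bot_def,
      id, Prod.mk.injEq] at *
    by_cases h3 : (a = i ∧ b = r) ∨ (a = r ∧ b = j)
    · exact Or.inl ⟨a, b, by omega⟩
    · by_cases h4 : b ≤ r
      · exact Or.inr (Or.inl ⟨a, b, by omega⟩)
      · exact Or.inr (Or.inr ⟨a, b, by omega⟩)
  all_goals
    simp only [Setoid.bot_def, ChordCross, polygonSides, diagonals, Set.mem_ofPred_eq, Prod.forall,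
      id, Prod.mk.injEq]
    intros
    first
    | trivial
    | omega

/-- The apex is the farthest `r` joined to `i`, where the edge to `i + 1` counts as a join. A chord
of `T` that crosses `(r, j)` would either start at `i` and end beyond `r`, or cross `(i, r)`. For
uniqueness, a smaller apex `s` would bring a side `(s, j)` that crosses `(i, r)`. -/
theorem exists_polygon_apex {i j : ℤ} (hij : i + 2 ≤ j) {T : Set (ℤ × ℤ)}
    (hT : IsFacet (diagonals i j) ChordCross T) :
    ∃! r, r ∈ Finset.Ioo i j ∧ polygonSides i j r ⊆ T := by
  have hb : ∃ b : ℤ, ∀ z, (z = i + 1 ∨ (i, z) ∈ T) → z ≤ b := by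
    refine ⟨j, ?_⟩
    rintro z (rfl | hz)
    · omega
    · exact ((hT _).1 hz).1.2.2.1
  obtain ⟨r, hr, hmax⟩ := Int.exists_greatest_of_bdd hb ⟨i + 1, Or.inl rfl⟩
  have hrij : i < r ∧ r < j := by
    rcases hr with rfl | hr
    · omega
    · have := ((hT _).1 hr).1
      simp [diagonals] at this
      omega
  refine ⟨r, ⟨Finset.mem_Ioo.2 hrij, ?_⟩, ?_⟩
  · rintro p ⟨hp, rfl | rfl⟩
    · rcases hr with rfl | hr
      · have := hp.2.1
        simp only at this
        omega
      · exact hr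
    · refine (hT _).2 ⟨hp, ?_⟩
      rintro ⟨c, d⟩ hq hc
      have hq' := ((hT _).1 hq).1
      have h1 : c = i → d ≤ r := fun h => hmax d (Or.inr (h ▸ hq))
      have h2 : r = i + 1 ∨ ¬ ChordCross (c, d) (i, r) := hr.imp id fun h => ((hT _).1 hq).2 _ h
      simp only [diagonals, ChordCross, Set.mem_ofPred_eq] at *
      omega
  · rintro s ⟨hs, hsT⟩
    rw [Finset.mem_Ioo] at hs
    have hs1 : s ≤ r := by
      by_cases h : s = i + 1
      · omega
      · refine hmax s (Or.inr (hsT ⟨⟨le_rfl, ?_, hs.2.le, ?_⟩, Or.inl rfl⟩))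
        · simp only; omega
        · simp only; omega
    by_contra hne
    rcases hr with rfl | hr
    · omega
    · refine ((hT _).1 hr).2 (s, j) (hsT ⟨⟨hs.1.le, ?_, le_rfl, ?_⟩, Or.inr rfl⟩) ?_
      · simp only; omega
      · simp only; omega
      · simp only [ChordCross]; omega

/-- The polygon with `k + 2` vertices has `catalan k` triangulations. -/
theorem card_polygon_facets (k : ℕ) : ∀ i j : ℤ, j = i + k + 1 →
    Nat.card (Facet (diagonals i j) ChordCross) = catalan k := by
  induction k using Nat.strong_induction_on with
  | _ k ih =>
  intro i j hj
  rcases k with _ | k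
  · have hD : diagonals i j = ∅ := by
      ext p
      simp only [diagonals, Set.mem_ofPred_eq, Set.mem_empty_iff_false, iff_false]
      omega
    rw [catalan_zero, Nat.card_eq_one_iff_unique]
    refine ⟨⟨fun S T => Subtype.ext ?_⟩, ⟨⟨∅, fun p => by simp [hD]⟩⟩⟩
    have : ∀ S : Facet (diagonals i j) ChordCross, S.1 = ∅ := by
      rintro ⟨S, hS⟩
      ext p
      rw [hS p, hD]
      simp
    rw [this S, this T]
  · have hcard : ∀ l : ℕ, l < k + 1 →
        Nat.card {T : Facet (diagonals i j) ChordCross // polygonSides i j (i + 1 + l) ⊆ T.1} =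
          catalan l * catalan (k - l) := by
      intro l hl
      have hcut := polygon_cut (i := i) (j := j) (r := i + 1 + l) (by omega) (by omega)
      rw [Nat.card_congr ((Equiv.subtypeSubtypeEquivSubtypeInter _ _).trans hcut.equiv),
        Nat.card_prod, ih l (by omega) _ _ (by omega), ih (k - l) (by omega) _ _ (by omega)]
    have hpos : ∀ l, catalan l ≠ 0 := fun l h => by
      have := succ_mul_catalan_eq_centralBinom l
      rw [h, mul_zero] at this
      exact (Nat.centralBinom_pos l).ne this
    rw [catalan_succ, card_eq_sum_of_existsUnique (Finset.univ : Finset (Fin (k + 1)))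
      (fun l (T : Facet (diagonals i j) ChordCross) => polygonSides i j (i + 1 + (l : ℕ)) ⊆ T.1)]
    · exact Finset.sum_congr rfl fun l _ => hcard l l.2
    · rintro ⟨T, hT⟩
      obtain ⟨r, ⟨hr, hrT⟩, hu⟩ := exists_polygon_apex (by omega) hT
      rw [Finset.mem_Ioo] at hr
      refine ⟨⟨(r - i - 1).toNat, by omega⟩, ⟨Finset.mem_univ _, ?_⟩, ?_⟩
      · have : i + 1 + ((r - i - 1).toNat : ℤ) = r := by omega
        simpa only [this] using hrT
      · rintro ⟨l, hl⟩ ⟨-, hl'⟩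
        have := hu (i + 1 + l) ⟨Finset.mem_Ioo.2 (by omega), hl'⟩
        ext
        simp only
        omega
    · intro l _
      rw [hcard l l.2]
      exact mul_ne_zero (hpos _) (hpos _)

end Annulus

namespace Annulus

/-! ### Arcs of the annulus, combinatorially -/

/-- Lifts of arcs to the universal cover. The marked points of either boundary component of the
cover are numbered by `ℤ`. -/
inductive Seg : Type
  | outer (a b : ℤ)
  | inner (a b : ℤ)
  | bridge (a b : ℤ)

namespace Seg

/-- The deck transformations, for `n` marked points outside and `m` inside. -/
def shift (n m k : ℤ) : Seg → Seg
  | outer a b => outer (a + k * n) (b + k * n)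
  | inner a b => inner (a + k * m) (b + k * m)
  | bridge a b => bridge (a + k * n) (b + k * m)

/-- The effect of `k` Dehn twists. -/
def twist (m k : ℤ) : Seg → Seg
  | outer a b => outer a b
  | inner a b => inner (a + k * m) (b + k * m)
  | bridge a b => bridge a (b + k * m)

/-- The segments that are lifts of arcs. -/
def Adm (n m : ℤ) : Seg → Prop
  | outer a b => a + 2 ≤ b ∧ b ≤ a + n
  | inner a b => a + 2 ≤ b ∧ b ≤ a + m
  | bridge _ _ => True

/-- The endpoints of two segments interleave on the boundary of the strip. -/
def Cross : Seg → Seg → Prop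
  | outer a b, outer c d => ChordCross (a, b) (c, d)
  | inner a b, inner c d => ChordCross (a, b) (c, d)
  | bridge a b, bridge c d => (a < c ∧ d < b) ∨ (c < a ∧ b < d)
  | outer a b, bridge c _ => a < c ∧ c < b
  | bridge c _, outer a b => a < c ∧ c < b
  | inner a b, bridge _ c => a < c ∧ c < b
  | bridge _ c, inner a b => a < c ∧ c < b
  | outer _ _, inner _ _ => False
  | inner _ _, outer _ _ => False

/-- Some lifts of the arcs cross. -/
def PeriodicCross (n m : ℤ) (p q : Seg) : Prop := ∃ k, Cross p (shift n m k q)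

theorem shift_zero (n m : ℤ) (p : Seg) : shift n m 0 p = p := by
  cases p <;> simp [shift]

theorem shift_shift (n m k l : ℤ) (p : Seg) :
    shift n m k (shift n m l p) = shift n m (l + k) p := by
  cases p <;> simp [shift, add_mul, add_assoc]

theorem twist_twist (m k l : ℤ) (p : Seg) : twist m k (twist m l p) = twist m (l + k) p := by
  cases p <;> simp [twist, add_mul, add_assoc]

theorem twist_zero (m : ℤ) (p : Seg) : twist m 0 p = p := by
  cases p <;> simp [twist]

theorem cross_comm (p q : Seg) : Cross p q ↔ Cross q p := by
  cases p <;> cases q <;> simp only [Cross, ChordCross] <;> omega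

theorem cross_shift (n m k : ℤ) (p q : Seg) :
    Cross (shift n m k p) (shift n m k q) ↔ Cross p q := by
  cases p <;> cases q <;> simp [Cross, ChordCross, shift]

theorem cross_twist_shift (n m k : ℤ) (p q : Seg) :
    (∃ j, Cross (twist m k p) (shift n m j (twist m k q))) ↔ PeriodicCross n m p q := by
  have : ∀ j, Cross (twist m k p) (shift n m j (twist m k q)) ↔ Cross p (shift n m j q) := by
    intro j
    cases p <;> cases q <;> simp only [Cross, ChordCross, shift, twist] <;> omega
  simp only [this, PeriodicCross]

theorem adm_shift (n m k : ℤ) (p : Seg) : Adm n m (shift n m k p) ↔ Adm n m p := by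
  cases p <;> simp only [Adm, shift] <;> omega

theorem adm_twist (n m k : ℤ) (p : Seg) : Adm n m (twist m k p) ↔ Adm n m p := by
  cases p <;> simp only [Adm, twist] <;> omega

theorem periodicCross_comm (n m : ℤ) (p q : Seg) :
    PeriodicCross n m p q ↔ PeriodicCross n m q p := by
  have key : ∀ p q, PeriodicCross n m p q → PeriodicCross n m q p := by
    rintro p q ⟨k, h⟩
    refine ⟨-k, ?_⟩
    rwa [cross_comm, ← cross_shift n m k, shift_shift, neg_add_cancel, shift_zero]
  exact ⟨key p q, key q p⟩

theorem periodicCross_shift_left (n m k : ℤ) (p q : Seg) :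
    PeriodicCross n m (shift n m k p) q ↔ PeriodicCross n m p q := by
  constructor
  · rintro ⟨l, h⟩
    refine ⟨l - k, ?_⟩
    rwa [← cross_shift n m k, shift_shift, sub_add_cancel]
  · rintro ⟨l, h⟩
    refine ⟨l + k, ?_⟩
    rwa [← cross_shift n m k, shift_shift] at h

/-- Segments are equivalent when they are lifts of the same arc. -/
def deckSetoid (n m : ℤ) : Setoid Seg where
  r p q := ∃ k, q = shift n m k p
  iseqv := by
    refine ⟨fun p => ⟨0, (shift_zero n m p).symm⟩, ?_, ?_⟩
    · rintro p q ⟨k, rfl⟩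
      exact ⟨-k, by rw [shift_shift, add_neg_cancel, shift_zero]⟩
    · rintro p q s ⟨k, rfl⟩ ⟨l, rfl⟩
      exact ⟨k + l, by rw [shift_shift]⟩

/-- This replaces the products `k * n` and `k * m` by linear bounds, which is all that `omega` needs
to know about translates. -/
theorem mul_cases {n m : ℤ} (hn : 1 ≤ n) (hm : 1 ≤ m) (k : ℤ) :
    k = 0 ∨ (1 ≤ k ∧ n ≤ k * n ∧ m ≤ k * m) ∨ (k ≤ -1 ∧ k * n ≤ -n ∧ k * m ≤ -m) := by
  rcases lt_trichotomy k 0 with h | h | h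
  · exact Or.inr (Or.inr ⟨by omega, by nlinarith, by nlinarith⟩)
  · exact Or.inl h
  · exact Or.inr (Or.inl ⟨by omega, by nlinarith, by nlinarith⟩)

theorem exists_add_mul_mem {m : ℤ} (hm : 1 ≤ m) (c u : ℤ) :
    ∃ k, u ≤ c + k * m ∧ c + k * m < u + m := by
  refine ⟨-((c - u) / m), ?_⟩
  have h1 := Int.emod_add_mul_ediv (c - u) m
  have h2 := Int.emod_nonneg (c - u) (by omega : m ≠ 0)
  have h3 := Int.emod_lt_of_pos (c - u) (by omega : 0 < m)
  have h4 : -((c - u) / m) * m = -(m * ((c - u) / m)) := by ring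
  omega

/-- An admissible segment on one boundary line has length at most a period, so its translates can
share an end with it but cannot interleave. Translates of a bridge keep the same order on both
lines. -/
theorem adm_not_cross {n m : ℤ} (hn : 1 ≤ n) (hm : 1 ≤ m) {p : Seg} (hp : Adm n m p) :
    ¬ PeriodicCross n m p p := by
  rintro ⟨k, hk⟩
  rcases mul_cases hn hm k with rfl | h | h <;> cases p <;>
    simp only [Cross, shift, Adm, ChordCross] at * <;> omega

/-- The sides of the triangle with vertices `x` outside and `u`, `v` inside. -/
def sides (x u v : ℤ) : Set Seg :=
  {s | s = bridge x u ∨ s = bridge x v ∨ (u + 2 ≤ v ∧ s = inner u v)}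

/-- The diagonals of the polygon with the vertices `x, …, x + n` (numbered `0, …, n`) outside and
`w, w - 1, …` (numbered `n + 1, n + 2, …`) inside. -/
def ofPolygon (n x w : ℤ) (p : ℤ × ℤ) : Seg :=
  if p.2 ≤ n then outer (x + p.1) (x + p.2)
  else if p.1 ≤ n then bridge (x + p.1) (w + n + 1 - p.2)
  else inner (w + n + 1 - p.2) (w + n + 1 - p.1)

/-- The inner arc with given ends. -/
def ofInner (p : ℤ × ℤ) : Seg := inner p.1 p.2

/-- The two bridges from `x` and their translates by one period bound a fundamental domain: the
triangle together with the two polygons. A segment that crosses none of the translates of the sides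
has a lift inside this domain. -/
theorem annulus_cover {n m : ℤ} (hn : 1 ≤ n) (hm : 1 ≤ m) {x u v : ℤ} (huv : u < v)
    (hv : v ≤ u + m) (y : Seg) (hy : Adm n m y) (hs : ∀ s ∈ sides x u v, ¬ PeriodicCross n m y s) :
    (∃ s ∈ sides x u v, deckSetoid n m y s) ∨
      (∃ p ∈ diagonals u v, deckSetoid n m y (ofInner p)) ∨
      ∃ p ∈ diagonals 0 (n + 1 + (u + m - v)), deckSetoid n m y (ofPolygon n x (u + m) p) := by
  have main : ∀ k, (shift n m k y ∈ sides x u v ∨ (∃ p ∈ diagonals u v, shift n m k y = ofInner p) ∨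
      ∃ p ∈ diagonals 0 (n + 1 + (u + m - v)), shift n m k y = ofPolygon n x (u + m) p) →
      (∃ s ∈ sides x u v, deckSetoid n m y s) ∨
      (∃ p ∈ diagonals u v, deckSetoid n m y (ofInner p)) ∨
      ∃ p ∈ diagonals 0 (n + 1 + (u + m - v)), deckSetoid n m y (ofPolygon n x (u + m) p) := by
    rintro k (h | ⟨p, hp, h⟩ | ⟨p, hp, h⟩)
    · exact Or.inl ⟨_, h, k, rfl⟩
    · exact Or.inr (Or.inl ⟨p, hp, k, h.symm⟩)
    · exact Or.inr (Or.inr ⟨p, hp, k, h.symm⟩)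
  have nc : ∀ k l, ∀ s ∈ sides x u v, ¬ Cross (shift n m k y) (shift n m l s) := by
    intro k l s hs' h
    exact hs s hs' ((periodicCross_shift_left n m k y s).1 ⟨l, h⟩)
  have nc1 := fun k l => nc k l (bridge x u) (Or.inl rfl)
  have nc2 := fun k l => nc k l (bridge x v) (Or.inr (Or.inl rfl))
  have nc3 : ∀ k l, u + 2 ≤ v → _ := fun k l h => nc k l (inner u v) (Or.inr (Or.inr ⟨h, rfl⟩))
  cases y with
  | outer a b =>
    obtain ⟨k, hk⟩ := exists_add_mul_mem hn a x
    -- The lift starts in `[x, x + n)`. The translate of the side `(x, u)` ends at `x + n`, which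
    -- stops the lift from passing that point.
    have h1 := nc1 k 1
    refine main k (Or.inr (Or.inr ⟨(a + k * n - x, b + k * n - x), ?_, ?_⟩))
    · simp only [Adm, shift, Cross, diagonals, Set.mem_ofPred_eq] at *
      omega
    · simp only [Adm, shift, Cross, ofPolygon] at *
      rw [if_pos (by omega)]
      congr 1 <;> omega
  | inner a b =>
    obtain ⟨k, hk⟩ := exists_add_mul_mem hm a u
    have h1 := nc1 k 1
    have h2 := nc2 k 0
    by_cases hb : b + k * m ≤ v
    · by_cases he : a + k * m = u ∧ b + k * m = v
      · refine main k (Or.inl (Or.inr (Or.inr ⟨?_, ?_⟩)))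
        · simp only [Adm] at hy
          omega
        · simp only [shift, he.1, he.2]
      · refine main k (Or.inr (Or.inl ⟨(a + k * m, b + k * m), ?_, rfl⟩))
        simp only [Adm, shift, Cross, diagonals, Set.mem_ofPred_eq] at *
        omega
    · refine main k (Or.inr (Or.inr
        ⟨(u + m + n + 1 - (b + k * m), u + m + n + 1 - (a + k * m)), ?_, ?_⟩))
      · simp only [Adm, shift, Cross, diagonals, Set.mem_ofPred_eq] at *
        omega
      · simp only [Adm, shift, Cross, ofPolygon] at *
        rw [if_neg (by omega), if_neg (by omega)]
        congr 1 <;> omega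
  | bridge a b =>
    -- The inner end is moved into `[v, v + m)`. The translated base `(u + m, v + m)` then forces it
    -- to be at most `u + m`, and the bridges force the outer end into `[x, x + n]`.
    obtain ⟨k, hk⟩ := exists_add_mul_mem hm b v
    have h1 := nc1 k 0
    have h2 := nc2 k 0
    have h3 := nc1 k 1
    have h4 := nc2 k 1
    have h5 := nc3 k 1
    by_cases he : a + k * n = x ∧ b + k * m = v
    · refine main k (Or.inl (Or.inr (Or.inl ?_)))
      simp only [shift, he.1, he.2]
    by_cases he' : a + k * n = x + n ∧ b + k * m = u + m
    -- The bridge from `x + n` to `u + m` is the translate by one period of the side from `x` to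
    -- `u`.
    · refine main (k - 1) (Or.inl (Or.inl ?_))
      simp only [shift]
      congr 1 <;> rw [sub_mul] <;> omega
    refine main k (Or.inr (Or.inr
        ⟨(a + k * n - x, u + m + n + 1 - (b + k * m)), ?_, ?_⟩))
    · simp only [shift, Cross, diagonals, Set.mem_ofPred_eq] at *
      omega
    · simp only [shift, Cross, ofPolygon] at *
      rw [if_neg (by omega), if_pos (by omega)]
      congr 1 <;> omega

theorem annulus_cut {n m : ℤ} (hn : 1 ≤ n) (hm : 1 ≤ m) {x u v : ℤ} (huv : u < v)
    (hv : v ≤ u + m) :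
    Cut (deckSetoid n m) {p | Adm n m p} (PeriodicCross n m) (sides x u v)
      (diagonals u v) ChordCross (diagonals 0 (n + 1 + (u + m - v))) ChordCross
      ofInner (ofPolygon n x (u + m)) where
  cross_congr := by
    rintro p q s t ⟨k, rfl⟩ ⟨l, rfl⟩ h
    rw [periodicCross_shift_left, periodicCross_comm, periodicCross_shift_left,
      periodicCross_comm]
    exact h
  mem_congr := by
    rintro p q ⟨k, rfl⟩ h
    exact (adm_shift n m k p).2 h
  symm p q := (periodicCross_comm n m p q).1
  irrefl p hp := adm_not_cross hn hm hp
  sides_mem := by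
    rintro s (rfl | rfl | ⟨h, rfl⟩) <;> simp only [Adm, Set.mem_ofPred_eq]
    omega
  sides := by
    rintro s hs t ht ⟨k, hk⟩
    rcases hs with (rfl | rfl | ⟨h, rfl⟩) <;> rcases ht with (rfl | rfl | ⟨h, rfl⟩) <;>
    rcases mul_cases hn hm k with rfl | h | h <;>
    simp only [Cross, shift, ChordCross] at * <;> omega
  mem₁ := by
    rintro ⟨a, b⟩ hp
    simp only [diagonals, ofInner, Adm, Set.mem_ofPred_eq] at *
    omega
  mem₂ := by
    rintro ⟨a, b⟩ hp
    simp only [diagonals, ofPolygon, Set.mem_ofPred_eq] at *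
    split_ifs <;> simp only [Adm] <;> omega
  cross₁ := by
    rintro ⟨a, b⟩ hp ⟨c, d⟩ hq
    refine ⟨?_, fun h => ⟨0, by simpa [shift, ofInner, Cross] using h⟩⟩
    rintro ⟨k, hk⟩
    simp only [diagonals, ofInner, Set.mem_ofPred_eq, shift, Cross, ChordCross] at *
    rcases mul_cases hn hm k with rfl | h | h <;> omega
  cross₂ := by
    rintro ⟨a, b⟩ hp ⟨c, d⟩ hq
    constructor
    · rintro ⟨k, hk⟩
      simp only [diagonals, ofPolygon, Set.mem_ofPred_eq] at *
      rcases mul_cases hn hm k with rfl | h | h <;> split_ifs at hk <;>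
        simp only [shift, Cross, ChordCross] at * <;> omega
    · intro h
      refine ⟨0, ?_⟩
      rw [shift_zero]
      simp only [diagonals, ofPolygon, Set.mem_ofPred_eq] at *
      split_ifs <;> simp only [Cross, ChordCross] at * <;> omega
  cross₁₂ := by
    rintro ⟨a, b⟩ hp ⟨c, d⟩ hq ⟨k, hk⟩
    simp only [diagonals, ofPolygon, ofInner, Set.mem_ofPred_eq] at *
    rcases mul_cases hn hm k with rfl | h | h <;> split_ifs at hk <;>
        simp only [shift, Cross, ChordCross] at * <;> omega
  cross₁s := by
    rintro ⟨a, b⟩ hp s hs ⟨k, hk⟩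
    rcases hs with (rfl | rfl | ⟨h, rfl⟩) <;> rcases mul_cases hn hm k with rfl | h | h <;>
    simp only [Cross, shift, ChordCross, ofInner, diagonals, Set.mem_ofPred_eq] at * <;> omega
  cross₂s := by
    rintro ⟨a, b⟩ hp s hs ⟨k, hk⟩
    simp only [diagonals, ofPolygon, Set.mem_ofPred_eq] at *
    rcases hs with (rfl | rfl | ⟨h, rfl⟩) <;> rcases mul_cases hn hm k with rfl | h | h <;>
    split_ifs at hk <;> simp only [Cross, shift, ChordCross] at * <;> omega
  inj₁ := by
    rintro ⟨a, b⟩ hp ⟨c, d⟩ hq ⟨k, hk⟩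
    simp only [diagonals, ofInner, Set.mem_ofPred_eq, shift, inner.injEq, Prod.mk.injEq] at *
    rcases mul_cases hn hm k with rfl | h | h <;> omega
  inj₂ := by
    rintro ⟨a, b⟩ hp ⟨c, d⟩ hq ⟨k, hk⟩
    simp only [diagonals, ofPolygon, Set.mem_ofPred_eq, Prod.mk.injEq] at *
    rcases mul_cases hn hm k with rfl | h | h <;> split_ifs at hk <;>
      simp only [shift, inner.injEq, outer.injEq, bridge.injEq, reduceCtorEq] at hk <;> omega
  ne₁₂ := by
    rintro ⟨a, b⟩ hp ⟨c, d⟩ hq ⟨k, hk⟩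
    simp only [diagonals, ofPolygon, ofInner, Set.mem_ofPred_eq] at *
    rcases mul_cases hn hm k with rfl | h | h <;> split_ifs at hk <;>
      simp only [shift, inner.injEq, reduceCtorEq] at hk <;> omega
  ne₁s := by
    rintro ⟨a, b⟩ hp s hs ⟨k, hk⟩
    simp only [diagonals, ofInner, Set.mem_ofPred_eq] at *
    rcases hs with (rfl | rfl | ⟨h, rfl⟩) <;> rcases mul_cases hn hm k with rfl | h | h <;>
      simp only [shift, inner.injEq, reduceCtorEq] at hk <;> omega
  ne₂s := by
    rintro ⟨a, b⟩ hp s hs ⟨k, hk⟩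
    simp only [diagonals, ofPolygon, Set.mem_ofPred_eq] at *
    rcases hs with (rfl | rfl | ⟨h, rfl⟩) <;> rcases mul_cases hn hm k with rfl | h | h <;>
      split_ifs at hk <;>
      simp only [shift, inner.injEq, bridge.injEq, reduceCtorEq] at hk <;> omega
  cover y hy hs := annulus_cover hn hm huv hv y hy hs

end Seg

end Annulus

/-! ### Counting combinatorial triangulations up to Dehn twists -/

namespace Annulus

/-- In a noncrossing family of bounded intervals, there is an edge or interval over the edge
`(0, 1)` whose ends are not covered. -/
theorem exists_outermost {m : ℤ} (hm : 1 ≤ m) (S : Set (ℤ × ℤ)) (hS : ∀ p ∈ S, p.2 ≤ p.1 + m)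
    (hc : ∀ p ∈ S, ∀ q ∈ S, ¬ ChordCross p q) :
    ∃ u v : ℤ, u ≤ 0 ∧ 1 ≤ v ∧ v ≤ u + m ∧ (v = u + 1 ∨ (u, v) ∈ S) ∧
      ∀ p ∈ S, ¬ (p.1 < u ∧ u < p.2) ∧ ¬ (p.1 < v ∧ v < p.2) := by
  -- The longest candidate over the edge is chosen. An interval that covers one of its ends crosses
  -- it or is a longer candidate.
  obtain ⟨l, ⟨u, v, hu, hv, huv, hS', rfl⟩, hmax⟩ := Int.exists_greatest_of_bdd
    (P := fun l => ∃ u v : ℤ, u ≤ 0 ∧ 1 ≤ v ∧ v ≤ u + m ∧ (v = u + 1 ∨ (u, v) ∈ S) ∧ v - u = l)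
    ⟨m, by rintro l ⟨u, v, h⟩; omega⟩ ⟨1, 0, 1, by omega⟩
  refine ⟨u, v, hu, hv, huv, hS', ?_⟩
  rintro ⟨a, b⟩ hab
  have h1 := hS _ hab
  have h2 : v = u + 1 ∨ ¬ ChordCross (a, b) (u, v) := hS'.imp id fun h => hc _ hab _ h
  have h3 : a ≤ 0 → 1 ≤ b → b - a ≤ v - u := fun ha hb =>
    hmax _ ⟨a, b, ha, hb, h1, Or.inr hab, rfl⟩
  simp only [ChordCross] at *
  omega

namespace Seg

/-- The combinatorial triangulations of the annulus. -/
abbrev Tri (n m : ℤ) : Type := Facet {p | Adm n m p} (PeriodicCross n m)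

theorem Tri.shift_mem {n m : ℤ} (T : Tri n m) (k : ℤ) {p : Seg} (hp : p ∈ T.1) :
    shift n m k p ∈ T.1 := by
  have h := (T.2 p).1 hp
  refine (T.2 _).2 ⟨(adm_shift n m k p).2 h.1, fun q hq hc => h.2 q hq ?_⟩
  rwa [periodicCross_shift_left] at hc

theorem Tri.not_cross {n m : ℤ} (T : Tri n m) {p q : Seg} (hp : p ∈ T.1) (hq : q ∈ T.1) :
    ¬ Cross p q := fun h => ((T.2 p).1 hp).2 q hq ⟨0, by rwa [shift_zero]⟩

/-- As `T` is invariant under deck translations, only the given lift needs to be tested against `T`.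
-/
theorem Tri.mem_of_not_cross {n m : ℤ} (T : Tri n m) {p : Seg} (hp : Adm n m p)
    (h : ∀ q ∈ T.1, ¬ Cross p q) : p ∈ T.1 :=
  (T.2 p).2 ⟨hp, fun _ hq ⟨k, hk⟩ => h _ (T.shift_mem k hq) hk⟩

/-- Without bridges, there is an uncovered vertex on each boundary line, by `exists_outermost`. The
bridge between them crosses nothing, against maximality. -/
theorem Tri.exists_bridge {n m : ℤ} (hn : 1 ≤ n) (hm : 1 ≤ m) (T : Tri n m) :
    ∃ a b, bridge a b ∈ T.1 := by
  by_contra! hno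
  obtain ⟨u, _, -, -, -, -, hu⟩ := exists_outermost hn {p | outer p.1 p.2 ∈ T.1}
    (fun p hp => ((T.2 _).1 hp).1.2) (fun _ hp _ hq => T.not_cross hp hq)
  obtain ⟨v, _, -, -, -, -, hv⟩ := exists_outermost hm {p | inner p.1 p.2 ∈ T.1}
    (fun p hp => ((T.2 _).1 hp).1.2) (fun _ hp _ hq => T.not_cross hp hq)
  refine hno u v (T.mem_of_not_cross trivial ?_)
  rintro (⟨a, b⟩ | ⟨a, b⟩ | ⟨a, b⟩) hq
  · exact (hu (a, b) hq).1
  · exact (hv (a, b) hq).1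
  · exact (hno a b hq).elim

/-- With `(u, v)` outermost, no bridge ends strictly between `u` and `v`. Let `x` be the largest
outer end of a bridge whose inner end is at most `u`. A bridge that crossed one of the two new sides
would violate this choice or cross the bridge that realizes `x`, and an outer arc over `x` would
cross that bridge as well. By maximality, both sides belong to `T`. -/
theorem Tri.exists_sides {n m : ℤ} (hn : 1 ≤ n) (hm : 1 ≤ m) (T : Tri n m) :
    ∃ x u v, u ≤ 0 ∧ 1 ≤ v ∧ v ≤ u + m ∧ sides x u v ⊆ T.1 := by
  obtain ⟨u, v, hu, hv, huv, hS, hcov⟩ := exists_outermost hm {p | inner p.1 p.2 ∈ T.1}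
    (fun p hp => ((T.2 _).1 hp).1.2) (fun _ hp _ hq => T.not_cross hp hq)
  obtain ⟨a₀, b₀, hab⟩ := T.exists_bridge hn hm
  have hsplit : ∀ a b, bridge a b ∈ T.1 → b ≤ u ∨ v ≤ b := by
    intro a b h
    rcases hS with h' | h'
    · omega
    · have := T.not_cross h h'
      simp only [Cross] at this
      omega
  -- Two consecutive translates of one bridge lie on either side of `(u, v)`: the right one bounds
  -- `x` from above, the left one shows that candidates exist.
  obtain ⟨k, hk⟩ := exists_add_mul_mem hm b₀ v
  have hR := T.shift_mem k hab
  have hL := T.shift_mem (k - 1) hab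
  simp only [shift] at hR hL
  obtain ⟨x, ⟨b, hbu, hxb⟩, hmax⟩ := Int.exists_greatest_of_bdd
    (P := fun x => ∃ b, b ≤ u ∧ bridge x b ∈ T.1)
    ⟨a₀ + k * n, by
      rintro z ⟨b, hb, hz⟩
      have := T.not_cross hz hR
      simp only [Cross] at this
      omega⟩
    ⟨a₀ + (k - 1) * n, _, by
      have := hsplit _ _ hL
      rw [sub_mul] at this ⊢
      omega, hL⟩
  refine ⟨x, u, v, hu, hv, huv, ?_⟩
  rintro s (rfl | rfl | ⟨h, rfl⟩)
  · refine T.mem_of_not_cross trivial ?_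
    rintro (⟨c, d⟩ | ⟨c, d⟩ | ⟨c, d⟩) hq
    · exact fun h => T.not_cross hxb hq h
    · exact (hcov (c, d) hq).1
    · have h1 := hsplit _ _ hq
      have h2 : d ≤ u → c ≤ x := fun h => hmax c ⟨d, h, hq⟩
      have h3 := T.not_cross hxb hq
      simp only [Cross] at *
      omega
  · refine T.mem_of_not_cross trivial ?_
    rintro (⟨c, d⟩ | ⟨c, d⟩ | ⟨c, d⟩) hq
    · exact fun h => T.not_cross hxb hq h
    · exact (hcov (c, d) hq).2
    · have h1 := hsplit _ _ hq
      have h2 : d ≤ u → c ≤ x := fun h => hmax c ⟨d, h, hq⟩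
      have h3 := T.not_cross hxb hq
      simp only [Cross] at *
      omega
  · exact hS.resolve_left (by omega)

/-- The bridges of one triangle cannot end strictly inside the base of the other, and both bases
contain the edge from `0` to `1`, so each base contains the other. Over a common base, two different
apices would make a pair of sides cross. -/
theorem Tri.sides_unique {n m : ℤ} (T : Tri n m) {x u v x' u' v' : ℤ}
    (hu : u ≤ 0) (hv : 1 ≤ v) (hu' : u' ≤ 0) (hv' : 1 ≤ v') (h : sides x u v ⊆ T.1)
    (h' : sides x' u' v' ⊆ T.1) : x = x' ∧ u = u' ∧ v = v' := by
  have key : ∀ {x u v x' u' v' : ℤ}, u ≤ 0 → 1 ≤ v → u' ≤ 0 → 1 ≤ v' → sides x u v ⊆ T.1 →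
      sides x' u' v' ⊆ T.1 → u ≤ u' ∧ v' ≤ v := by
    intro x u v x' u' v' hu hv hu' hv' h h'
    by_cases hs : u' + 2 ≤ v'
    · have h0 := h' (Or.inr (Or.inr ⟨hs, rfl⟩))
      have h1 := T.not_cross (h (Or.inl rfl)) h0
      have h2 := T.not_cross (h (Or.inr (Or.inl rfl))) h0
      simp only [Cross] at h1 h2
      by_cases hs' : u + 2 ≤ v
      · have h3 := T.not_cross (h (Or.inr (Or.inr ⟨hs', rfl⟩))) h0
        simp only [Cross, ChordCross] at h3
        omega
      · omega
    · omega
  have h1 := key hu hv hu' hv' h h'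
  have h2 := key hu' hv' hu hv h' h
  obtain rfl : u = u' := by omega
  obtain rfl : v = v' := by omega
  have h3 := T.not_cross (h (Or.inl rfl)) (h' (Or.inr (Or.inl rfl)))
  have h4 := T.not_cross (h (Or.inr (Or.inl rfl))) (h' (Or.inl rfl))
  simp only [Cross] at h3 h4
  omega

theorem card_tri_sides (n m i j : ℕ) (hn : 1 ≤ n) (hi : i < m) (x : ℤ) :
    Nat.card {T : Tri n m // sides x (-j) (i + 1 - j) ⊆ T.1} =
      catalan i * catalan (n + m - i - 1) := by
  have hcut := annulus_cut (n := n) (m := m) (by omega) (by omega) (x := x) (u := -j)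
    (v := i + 1 - j) (by omega) (by omega)
  rw [Nat.card_congr ((Equiv.subtypeSubtypeEquivSubtypeInter _ _).trans hcut.equiv),
    Nat.card_prod, card_polygon_facets i _ _ (by omega),
    card_polygon_facets (n + m - i - 1) _ _ (by omega)]

/-- The image of a triangulation under Dehn twists. -/
def Tri.twist {n m : ℤ} (k : ℤ) (T : Tri n m) : Tri n m :=
  ⟨{p | Seg.twist m k p ∈ T.1}, fun p => by
    rw [Set.mem_ofPred_eq, T.2, Set.mem_ofPred_eq, Set.mem_ofPred_eq, adm_twist]
    refine and_congr_right fun _ => ⟨fun h q hq hc => h _ hq ?_, fun h q hq hc => ?_⟩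
    · exact (cross_twist_shift n m k p q).2 hc
    · have hq' : Seg.twist m k (Seg.twist m (-k) q) = q := by
        rw [twist_twist, neg_add_cancel, twist_zero]
      refine h (Seg.twist m (-k) q) (by rwa [Set.mem_ofPred_eq, hq']) ?_
      rw [← cross_twist_shift n m k, hq']
      exact hc⟩

/-- Twisting the bridge from `x + k * n` to `u` gives a deck translate of the bridge from `x` to
`u`. Hence twists act on the normalizing triangle only through its apex. -/
theorem Tri.sides_twist {n m : ℤ} {T : Tri n m} {k x u v : ℤ} (h : sides x u v ⊆ T.1) :
    sides (x + k * n) u v ⊆ (T.twist k).1 := by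
  rintro s (rfl | rfl | ⟨hs, rfl⟩)
  · exact T.shift_mem k (h (Or.inl rfl))
  · exact T.shift_mem k (h (Or.inr (Or.inl rfl)))
  · exact T.shift_mem k (h (Or.inr (Or.inr ⟨hs, rfl⟩)))

/-- The number of combinatorial triangulations up to Dehn twists. -/
theorem card_quotient_tri {X : Type*} {n m : ℕ} (hn : 1 ≤ n) (hm : 1 ≤ m) (e : X ≃ Tri n m)
    (s : Setoid X) (hs : ∀ T T', s T T' ↔ ∃ k, (e T).twist k = e T') :
    Nat.card (Quotient s) =
      n * ∑ i ∈ Finset.range m, (i + 1) * catalan i * catalan (n + m - i - 1) := by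
  have hn' : (1 : ℤ) ≤ n := by omega
  have hm' : (1 : ℤ) ≤ m := by omega
  -- The normalized triangulations, with apex in `[0, n)`, contain exactly one member of each class.
  let N := {T : Tri n m //
    ∃ x u v : ℤ, 0 ≤ x ∧ x < n ∧ u ≤ 0 ∧ 1 ≤ v ∧ v ≤ u + m ∧ sides x u v ⊆ T.1}
  let f : N → Quotient s := fun T => Quotient.mk s (e.symm T.1)
  have hf : Function.Bijective f := by
    constructor
    · rintro ⟨T, x, u, v, hx, hxn, hu, hv, huv, hT⟩ ⟨T', x', u', v', hx', hxn', hu', hv', huv', hT'⟩ h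
      obtain ⟨k, hk⟩ := (hs _ _).1 (Quotient.exact h)
      rw [Equiv.apply_symm_apply, Equiv.apply_symm_apply] at hk
      subst hk
      have := (Tri.sides_unique _ hu hv hu' hv' (Tri.sides_twist hT) hT').1
      have hk : k = 0 := by
        rcases mul_cases hn' hm' k with h | h | h <;> omega
      subst hk
      refine Subtype.ext (Subtype.ext (Set.ext fun p => ?_))
      change p ∈ T.1 ↔ Seg.twist m 0 p ∈ T.1
      rw [twist_zero]
    · intro q
      induction q using Quotient.inductionOn with
      | h T =>
        obtain ⟨x, u, v, hu, hv, huv, hT⟩ := (e T).exists_sides hn' hm'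
        obtain ⟨k, hk⟩ := exists_add_mul_mem hn' x 0
        refine ⟨⟨(e T).twist k, x + k * n, u, v, hk.1, by omega, hu, hv, huv,
          Tri.sides_twist hT⟩, ?_⟩
        refine Quotient.sound (s.symm' ((hs _ _).2 ⟨k, ?_⟩))
        rw [Equiv.apply_symm_apply]
  rw [← Nat.card_eq_of_bijective f hf]
  -- The index `(x, i, j)` stands for the apex `x` and the base from `-j` to `i + 1 - j`. The base
  -- contains the edge from `0` to `1` exactly when `0 ≤ j ≤ i`.
  let I : Finset (ℕ × Σ _ : ℕ, ℕ) :=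
    Finset.range n ×ˢ (Finset.range m).sigma fun i => Finset.range (i + 1)
  let P : (ℕ × Σ _ : ℕ, ℕ) → N → Prop := fun d T =>
    sides d.1 (-(d.2.2 : ℤ)) ((d.2.1 : ℤ) + 1 - d.2.2) ⊆ T.1.1
  have hI : ∀ d, d ∈ I ↔ d.1 < n ∧ d.2.1 < m ∧ d.2.2 ≤ d.2.1 := by
    intro d
    simp only [I, Finset.mem_product, Finset.mem_range, Finset.mem_sigma]
    omega
  have hcard : ∀ d ∈ I, Nat.card {T // P d T} = catalan d.2.1 * catalan (n + m - d.2.1 - 1) := by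
    intro d hd
    rw [hI] at hd
    rw [← card_tri_sides n m d.2.1 d.2.2 hn hd.2.1 d.1]
    refine Nat.card_congr (Equiv.subtypeSubtypeEquivSubtype (α := Tri n m)
      (q := fun T => sides d.1 (-(d.2.2 : ℤ)) ((d.2.1 : ℤ) + 1 - d.2.2) ⊆ T.1) ?_)
    intro T hT
    exact ⟨d.1, _, _, by omega, by omega, by omega, by omega, by omega, hT⟩
  have hpos : ∀ l, catalan l ≠ 0 := fun l h => by
    have := succ_mul_catalan_eq_centralBinom l
    rw [h, mul_zero] at this
    exact (Nat.centralBinom_pos l).ne this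
  rw [card_eq_sum_of_existsUnique I P]
  · rw [Finset.sum_congr rfl hcard, Finset.sum_product]
    simp only [Finset.sum_sigma, Finset.sum_const, Finset.card_range, smul_eq_mul, mul_assoc]
  · rintro ⟨T, x, u, v, hx, hxn, hu, hv, huv, hT⟩
    refine ⟨(x.toNat, ⟨(v - u - 1).toNat, (-u).toNat⟩), ⟨(hI _).2 ?_, ?_⟩, ?_⟩
    · simp only
      omega
    · change sides _ _ _ ⊆ T.1
      simp only
      convert hT using 2 <;> omega
    · rintro ⟨x', i, j⟩ ⟨hd, hd'⟩
      rw [hI] at hd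
      have := Tri.sides_unique T hu hv (by omega) (by dsimp only at hd ⊢; omega) hT hd'
      simp only at this hd
      simp only [Prod.mk.injEq, Sigma.mk.injEq]
      refine ⟨by omega, by omega, heq_of_eq (by omega)⟩
  · intro d hd
    rw [hcard d hd]
    exact mul_ne_zero (hpos _) (hpos _)

end Seg

end Annulus

namespace Annulus

open Real unitInterval

/-! ### Crossing paths in a strip -/

/-- A nowhere vanishing planar vector field on a square has a continuous angle. -/
theorem exists_angle (X Y : C(I × I, ℝ)) (h : ∀ p, ¬ (X p = 0 ∧ Y p = 0)) :
    ∃ θ : C(I × I, ℝ), ∀ p, ∃ r : ℝ, 0 < r ∧ X p = r * cos (θ p) ∧ Y p = r * sin (θ p) := by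
  -- The field is extended to the plane by projection onto the square, and is then lifted through
  -- `exp` from this simply connected domain.
  let c : ℝ → I := Set.projIcc 0 1 zero_le_one
  have hc : Continuous c := continuous_projIcc
  let F : C(ℝ × ℝ, ℂ) := ⟨fun p => (X (c p.1, c p.2) : ℂ) + (Y (c p.1, c p.2) : ℂ) * Complex.I, by
    fun_prop⟩
  have hre : ∀ p, (F p).re = X (c p.1, c p.2) := fun p => by simp [F]
  have him : ∀ p, (F p).im = Y (c p.1, c p.2) := fun p => by simp [F]
  have hF : ∀ p, F p ≠ 0 := fun p hp =>
    h (c p.1, c p.2) ⟨by rw [← hre, hp]; rfl, by rw [← him, hp]; rfl⟩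
  obtain ⟨G, ⟨-, hG⟩, -⟩ := Complex.isCoveringMapOn_exp.existsUnique_continuousMap_lifts F
    (a₀ := (0, 0)) (Complex.exp_log (hF _)) (fun p => hF p)
  refine ⟨⟨fun p => (G (p.1, p.2)).im, by fun_prop⟩, fun p =>
    ⟨exp (G (p.1, p.2)).re, exp_pos _, ?_, ?_⟩⟩
  · have h1 : Complex.exp (G (p.1, p.2)) = F (p.1, p.2) := congrFun hG _
    have h2 := hre (p.1, p.2)
    rw [← h1, Complex.exp_re] at h2
    simpa [c] using h2.symm
  · have h1 : Complex.exp (G (p.1, p.2)) = F (p.1, p.2) := congrFun hG _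
    have h2 := him (p.1, p.2)
    rw [← h1, Complex.exp_im] at h2
    simpa [c] using h2.symm

theorem sin_neg_of_mem {x : ℝ} {k : ℤ} (h₁ : 2 * π * k - π < x) (h₂ : x < 2 * π * k) :
    sin x < 0 := by
  have := sin_neg_of_neg_of_neg_pi_lt (x := x - k * (2 * π)) (by linarith) (by linarith)
  rwa [sin_sub_int_mul_two_pi] at this

theorem sin_pos_of_mem {x : ℝ} {k : ℤ} (h₁ : 2 * π * k < x) (h₂ : x < 2 * π * k + π) :
    0 < sin x := by
  have := sin_pos_of_pos_of_lt_pi (x := x - k * (2 * π)) (by linarith) (by linarith)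
  rwa [sin_sub_int_mul_two_pi] at this

theorem eq_of_mem_half_turn {x : ℝ} {k l : ℤ} (h₁ : 2 * π * k < x ∧ x < 2 * π * k + π)
    (h₂ : 2 * π * l < x ∧ x < 2 * π * l + π) : k = l := by
  have hp := pi_pos
  have h3 : (k : ℝ) < l + 1 := by nlinarith
  have h4 : (l : ℝ) < k + 1 := by nlinarith
  have h3' : k < l + 1 := by exact_mod_cast h3
  have h4' : l < k + 1 := by exact_mod_cast h4
  omega

/-- An angle that stays in the upper half-plane stays in a fixed half turn. -/
theorem exists_half_turn (φ : I → ℝ) (hφ : Continuous φ) (hs : ∀ t, 0 ≤ sin (φ t)) :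
    ∃ k : ℤ, ∀ t, (sin (φ t) = 0 → cos (φ t) < 0 → φ t = 2 * π * k + π) ∧
      (sin (φ t) = 0 → 0 < cos (φ t) → φ t = 2 * π * k) ∧
      (0 < sin (φ t) → 2 * π * k < φ t ∧ φ t < 2 * π * k + π) := by
  have hp := pi_pos
  have hoc := (isPreconnected_range hφ).ordConnected
  set k := ⌊φ 0 / (2 * π)⌋
  have hk1 : 2 * π * k ≤ φ 0 := by
    have := Int.floor_le (φ 0 / (2 * π))
    rw [le_div_iff₀ (by positivity)] at this
    linarith
  have hk2 : φ 0 < 2 * π * k + 2 * π := by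
    have := Int.lt_floor_add_one (φ 0 / (2 * π))
    rw [div_lt_iff₀ (by positivity)] at this
    linarith
  -- The floor leaves a full turn. Its second half is excluded because the sine is negative there.
  have hk3 : φ 0 ≤ 2 * π * k + π := by
    by_contra! h
    refine (hs 0).not_gt (sin_neg_of_mem (k := k + 1) ?_ ?_) <;> push_cast <;> linarith
  have hmem : ∀ t, 2 * π * k ≤ φ t ∧ φ t ≤ 2 * π * k + π := by
    intro t
    constructor
    · by_contra! h
      obtain ⟨z, hz⟩ := hoc.out (Set.mem_range_self t) (Set.mem_range_self 0)
        -- To leave the half turn downwards, the angle would have to take a value within `π / 2`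
        -- below `2 * π * k`, where the sine is negative.
        (⟨le_max_left _ _, max_le (by linarith) (by linarith)⟩ :
          max (φ t) (2 * π * k - π / 2) ∈ Set.Icc (φ t) (φ 0))
      refine (hs z).not_gt (sin_neg_of_mem (k := k) ?_ ?_) <;> rw [hz]
      · exact lt_max_of_lt_right (by linarith)
      · exact max_lt h (by linarith)
    · by_contra! h
      obtain ⟨z, hz⟩ := hoc.out (Set.mem_range_self 0) (Set.mem_range_self t)
        (⟨le_min (by linarith) (by linarith), min_le_left _ _⟩ :
          min (φ t) (2 * π * k + π + π / 2) ∈ Set.Icc (φ 0) (φ t))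
      refine (hs z).not_gt (sin_neg_of_mem (k := k + 1) ?_ ?_) <;> rw [hz] <;> push_cast
      · exact lt_min (by linarith) (by linarith)
      · exact min_lt_of_right_lt (by linarith)
  have hcos : ∀ x : ℝ, cos (x + 2 * π * k) = cos x := fun x => by
    rw [show x + 2 * π * k = x + k * (2 * π) by ring, cos_add_int_mul_two_pi]
  have hlow : cos (2 * π * k) = 1 := by simpa using hcos 0
  have hupp : cos (2 * π * k + π) = -1 := by
    rw [add_comm, hcos, cos_pi]
  refine ⟨k, fun t => ⟨fun h0 hc => ?_, fun h0 hc => ?_, fun hpos => ?_⟩⟩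
  · by_contra hne
    rcases (hmem t).1.eq_or_lt with h | h
    · rw [← h, hlow] at hc
      linarith
    · exact (sin_pos_of_mem h (lt_of_le_of_ne (hmem t).2 hne)).ne' h0
  · by_contra hne
    rcases (hmem t).2.eq_or_lt with h | h
    · rw [h, hupp] at hc
      linarith
    · exact (sin_pos_of_mem (lt_of_le_of_ne (hmem t).1 (Ne.symm hne)) h).ne' h0
  · have hs1 : sin (2 * π * k) = 0 := by
      rw [show 2 * π * k = 0 + k * (2 * π) by ring, sin_add_int_mul_two_pi, sin_zero]
    have hs2 : sin (2 * π * k + π) = 0 := by rw [sin_add_pi, hs1, neg_zero]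
    refine ⟨lt_of_le_of_ne (hmem t).1 fun h => ?_, lt_of_le_of_ne (hmem t).2 fun h => ?_⟩
    · rw [← h, hs1] at hpos
      exact hpos.false
    · rw [h, hs2] at hpos
      exact hpos.false

/-- The variation of an angle along a side of the square on which the vector field points into the
closed upper half-plane. -/
theorem exists_angle_upper {X Y θ : I → ℝ} (hθ : Continuous θ)
    (h : ∀ t, ∃ r : ℝ, 0 < r ∧ X t = r * cos (θ t) ∧ Y t = r * sin (θ t)) (hY : ∀ t, 0 ≤ Y t) :
    ∃ k : ℤ, ∀ t, (Y t = 0 → X t < 0 → θ t = 2 * π * k + π) ∧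
      (Y t = 0 → 0 < X t → θ t = 2 * π * k) ∧
      (0 < Y t → 2 * π * k < θ t ∧ θ t < 2 * π * k + π) := by
  obtain ⟨k, hk⟩ := exists_half_turn θ hθ fun t => by
    obtain ⟨r, hr, -, h2⟩ := h t
    have := hY t
    rw [h2] at this
    exact nonneg_of_mul_nonneg_right this hr
  refine ⟨k, fun t => ?_⟩
  obtain ⟨r, hr, h1, h2⟩ := h t
  have h3 : Y t = 0 → sin (θ t) = 0 := fun h0 => by
    rw [h2] at h0
    exact (mul_eq_zero.1 h0).resolve_left hr.ne'
  refine ⟨fun h0 hx => (hk t).1 (h3 h0) ?_, fun h0 hx => (hk t).2.1 (h3 h0) ?_,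
    fun hy => (hk t).2.2 ?_⟩
  · rw [h1] at hx
    exact neg_of_mul_neg_right hx hr.le
  · rw [h1] at hx
    exact pos_of_mul_pos_right hx hr.le
  · rw [h2] at hy
    exact pos_of_mul_pos_right hy hr.le

/-- The same for the lower half-plane. -/
theorem exists_angle_lower {X Y θ : I → ℝ} (hθ : Continuous θ)
    (h : ∀ t, ∃ r : ℝ, 0 < r ∧ X t = r * cos (θ t) ∧ Y t = r * sin (θ t)) (hY : ∀ t, Y t ≤ 0) :
    ∃ k : ℤ, ∀ t, (Y t = 0 → 0 < X t → θ t = 2 * π * k) ∧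
      (Y t = 0 → X t < 0 → θ t + π = 2 * π * k) ∧
      (Y t < 0 → 2 * π * k < θ t + π ∧ θ t + π < 2 * π * k + π) := by
  obtain ⟨k, hk⟩ := exists_angle_upper (X := fun t => -X t) (Y := fun t => -Y t)
    (θ := fun t => θ t + π) (by fun_prop) (fun t => by
      obtain ⟨r, hr, h1, h2⟩ := h t
      exact ⟨r, hr, by rw [h1, cos_add_pi, mul_neg], by rw [h2, sin_add_pi, mul_neg]⟩)
    (fun t => by simpa using hY t)
  refine ⟨k, fun t => ⟨fun h0 hx => ?_, fun h0 hx => ?_, fun hy => ?_⟩⟩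
  · have := (hk t).1 (by simpa using h0) (by simpa using hx)
    linarith
  · exact (hk t).2.1 (by simpa using h0) (by simpa using hx)
  · exact (hk t).2.2 (by simpa using hy)

/-- The vector between two disjoint paths never vanishes. Its angle is single-valued on the square,
so the changes along the two routes between opposite corners must agree, while the positions of the
path ends prescribe these changes. -/
theorem exists_square_angle {x y x' y' : C(I, ℝ)} (hno : ∀ s t, ¬ (x s = x' t ∧ y s = y' t)) :
    ∃ θ : C(I × I, ℝ), ∀ s t, ∃ r : ℝ, 0 < r ∧ x s - x' t = r * cos (θ (s, t)) ∧
      y s - y' t = r * sin (θ (s, t)) := by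
  obtain ⟨θ, hθ⟩ := exists_angle ⟨fun p => x p.1 - x' p.2, by fun_prop⟩
    ⟨fun p => y p.1 - y' p.2, by fun_prop⟩
    (fun p ⟨h1, h2⟩ => hno p.1 p.2 ⟨sub_eq_zero.1 h1, sub_eq_zero.1 h2⟩)
  exact ⟨θ, fun s t => hθ (s, t)⟩

/-- Two paths in a strip whose endpoints interleave on the upper boundary line meet. -/
theorem exists_meet_of_interleave {x y x' y' : C(I, ℝ)} (hy : ∀ s, y s ∈ Set.Icc (0 : ℝ) 1)
    (hy' : ∀ s, y' s ∈ Set.Icc (0 : ℝ) 1)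
    (h0 : y 0 = 1) (h1 : y 1 = 1) (h0' : y' 0 = 1) (h1' : y' 1 = 1)
    (hac : x 0 < x' 0) (hcb : x' 0 < x 1) (hbd : x 1 < x' 1) :
    ∃ s t, x s = x' t ∧ y s = y' t := by
  by_contra! hno
  obtain ⟨θ, hθ⟩ := exists_square_angle (fun s t h => hno s t h.1 h.2)
  obtain ⟨k₀, hk₀⟩ := exists_angle_upper (θ := fun t => θ (0, t)) (by fun_prop) (hθ 0)
    (fun t => by linarith [(hy' t).2])
  obtain ⟨k₁, hk₁⟩ := exists_angle_upper (θ := fun t => θ (1, t)) (by fun_prop) (hθ 1)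
    (fun t => by linarith [(hy' t).2])
  obtain ⟨l₀, hl₀⟩ := exists_angle_lower (θ := fun s => θ (s, 0)) (by fun_prop) (fun s => hθ s 0)
    (fun t => by linarith [(hy t).2])
  obtain ⟨l₁, hl₁⟩ := exists_angle_lower (θ := fun s => θ (s, 1)) (by fun_prop) (fun s => hθ s 1)
    (fun t => by linarith [(hy t).2])
  have e1 := (hk₀ 0).1 (by linarith) (by linarith)
  have e2 := (hk₀ 1).1 (by linarith) (by linarith)
  have e3 := (hl₀ 0).2.1 (by linarith) (by linarith)
  have e4 := (hl₀ 1).1 (by linarith) (by linarith)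
  have e5 := (hk₁ 0).2.1 (by linarith) (by linarith)
  have e6 := (hk₁ 1).1 (by linarith) (by linarith)
  have e7 := (hl₁ 0).2.1 (by linarith) (by linarith)
  have e8 := (hl₁ 1).2.1 (by linarith) (by linarith)
  -- From `(0, 0)` to `(1, 1)`, the angle gains `2 * π` by way of `(1, 0)` and nothing by way of
  -- `(0, 1)`.
  linarith [pi_pos]

/-- A path between points of the upper boundary line of a strip meets every path from a point
between its endpoints to the lower boundary line. -/
theorem exists_meet_of_between {x y x' y' : C(I, ℝ)} (hy : ∀ s, y s ∈ Set.Icc (0 : ℝ) 1)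
    (hy' : ∀ s, y' s ∈ Set.Icc (0 : ℝ) 1)
    (h0 : y 0 = 1) (h1 : y 1 = 1) (h0' : y' 0 = 1) (h1' : y' 1 = 0)
    (hac : x 0 < x' 0) (hcb : x' 0 < x 1) :
    ∃ s t, x s = x' t ∧ y s = y' t := by
  by_contra! hno
  obtain ⟨θ, hθ⟩ := exists_square_angle (fun s t h => hno s t h.1 h.2)
  obtain ⟨k₀, hk₀⟩ := exists_angle_upper (θ := fun t => θ (0, t)) (by fun_prop) (hθ 0)
    (fun t => by linarith [(hy' t).2])
  obtain ⟨k₁, hk₁⟩ := exists_angle_upper (θ := fun t => θ (1, t)) (by fun_prop) (hθ 1)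
    (fun t => by linarith [(hy' t).2])
  obtain ⟨l₀, hl₀⟩ := exists_angle_lower (θ := fun s => θ (s, 0)) (by fun_prop) (fun s => hθ s 0)
    (fun t => by linarith [(hy t).2])
  obtain ⟨l₁, hl₁⟩ := exists_angle_upper (θ := fun s => θ (s, 1)) (by fun_prop) (fun s => hθ s 1)
    (fun t => by linarith [(hy t).1])
  have e1 := (hk₀ 0).1 (by linarith) (by linarith)
  have e2 := (hk₀ 1).2.2 (by linarith)
  have e3 := (hl₀ 0).2.1 (by linarith) (by linarith)
  have e4 := (hl₀ 1).1 (by linarith) (by linarith)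
  have e5 := (hk₁ 0).2.1 (by linarith) (by linarith)
  have e6 := (hk₁ 1).2.2 (by linarith)
  have e7 := (hl₁ 0).2.2 (by linarith)
  have e8 := (hl₁ 1).2.2 (by linarith)
  have e9 := eq_of_mem_half_turn e2 e7
  -- At these corners the vertical component is positive, so the angle is known only up to an open
  -- half turn. The two sides that meet at such a corner must have the same half turn.
  have e10 := eq_of_mem_half_turn e6 e8
  subst e9 e10
  linarith [pi_pos]

/-- Two paths across a strip whose endpoints are in opposite order meet. -/
theorem exists_meet_of_opposite {x y x' y' : C(I, ℝ)} (hy : ∀ s, y s ∈ Set.Icc (0 : ℝ) 1)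
    (hy' : ∀ s, y' s ∈ Set.Icc (0 : ℝ) 1)
    (h0 : y 0 = 1) (h1 : y 1 = 0) (h0' : y' 0 = 1) (h1' : y' 1 = 0)
    (hac : x 0 < x' 0) (hdb : x' 1 < x 1) :
    ∃ s t, x s = x' t ∧ y s = y' t := by
  by_contra! hno
  obtain ⟨θ, hθ⟩ := exists_square_angle (fun s t h => hno s t h.1 h.2)
  obtain ⟨k₀, hk₀⟩ := exists_angle_upper (θ := fun t => θ (0, t)) (by fun_prop) (hθ 0)
    (fun t => by linarith [(hy' t).2])
  obtain ⟨k₁, hk₁⟩ := exists_angle_lower (θ := fun t => θ (1, t)) (by fun_prop) (hθ 1)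
    (fun t => by linarith [(hy' t).1])
  obtain ⟨l₀, hl₀⟩ := exists_angle_lower (θ := fun s => θ (s, 0)) (by fun_prop) (fun s => hθ s 0)
    (fun t => by linarith [(hy t).2])
  obtain ⟨l₁, hl₁⟩ := exists_angle_upper (θ := fun s => θ (s, 1)) (by fun_prop) (fun s => hθ s 1)
    (fun t => by linarith [(hy t).1])
  have e1 := (hk₀ 0).1 (by linarith) (by linarith)
  have e2 := (hk₀ 1).2.2 (by linarith)
  have e3 := (hl₀ 0).2.1 (by linarith) (by linarith)
  have e4 := (hl₀ 1).2.2 (by linarith)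
  have e5 := (hk₁ 0).2.2 (by linarith)
  have e6 := (hk₁ 1).1 (by linarith) (by linarith)
  have e7 := (hl₁ 0).2.2 (by linarith)
  have e8 := (hl₁ 1).2.1 (by linarith) (by linarith)
  have e9 := eq_of_mem_half_turn e2 e7
  have e10 := eq_of_mem_half_turn e4 e5
  subst e9 e10
  linarith [pi_pos]

end Annulus

namespace Annulus

open unitInterval

/-! ### Lifts of curves to the universal cover -/

/-- `g` is the horizontal coordinate of a lift of the curve `γ` to the universal cover. -/
def Lifts (γ : Curve) (g : C(I, ℝ)) : Prop := ∀ s, ((g s : ℝ) : UnitAddCircle) = (γ s).1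

theorem exists_lift (γ : Curve) {x : ℝ} (hx : (x : UnitAddCircle) = (γ 0).1) :
    ∃ g, Lifts γ g ∧ g 0 = x := by
  obtain ⟨g, hg, hg0⟩ := (AddCircle.isCoveringMap_coe (1 : ℝ)).exists_path_lifts
    ⟨fun s => (γ s).1, by fun_prop⟩ x hx.symm
  exact ⟨g, fun s => congrFun hg s, hg0⟩

theorem Lifts.add_int {γ : Curve} {g : C(I, ℝ)} (h : Lifts γ g) (k : ℤ) :
    Lifts γ ⟨fun s => g s + k, by fun_prop⟩ := by
  intro s
  rw [← h s]
  simp only [ContinuousMap.coe_mk, AddCircle.coe_add]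
  rw [show ((k : ℝ) : UnitAddCircle) = 0 from (AddCircle.coe_eq_zero_iff 1).2 ⟨k, by simp⟩,
    add_zero]

theorem Lifts.reverse {γ : Curve} {g : C(I, ℝ)} (h : Lifts γ g) :
    Lifts γ.reverse (g.comp ⟨σ, continuous_symm⟩) := fun s => h (σ s)

theorem coe_eq_coe_iff_exists_int {x y : ℝ} :
    (x : UnitAddCircle) = y ↔ ∃ k : ℤ, x = y + k := by
  rw [← sub_eq_zero, ← AddCircle.coe_sub, AddCircle.coe_eq_zero_iff]
  refine exists_congr fun k => ?_
  rw [zsmul_eq_mul, mul_one]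
  constructor <;> intro h <;> linarith

theorem Homotopic.lift_one_eq {γ δ : Curve} (h : Homotopic γ δ) {g d : C(I, ℝ)}
    (hg : Lifts γ g) (hd : Lifts δ d) (h0 : g 0 = d 0) : g 1 = d 1 := by
  have cov := AddCircle.isCoveringMap_coe (1 : ℝ)
  let γ' : C(I, UnitAddCircle) := ⟨fun s => (γ s).1, by fun_prop⟩
  let δ' : C(I, UnitAddCircle) := ⟨fun s => (δ s).1, by fun_prop⟩
  have h' : ContinuousMap.HomotopicRel γ' δ' {0, 1} :=
    ContinuousMap.HomotopicRel.comp_continuousMap h ⟨Prod.fst, continuous_fst⟩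
  have e1 : γ' 0 = ((g 0 : ℝ) : UnitAddCircle) := (hg 0).symm
  have e2 : δ' 0 = ((g 0 : ℝ) : UnitAddCircle) := by rw [h0]; exact (hd 0).symm
  have := cov.liftPath_apply_one_eq_of_homotopicRel h' (g 0) e1 e2
  have hg' : g = cov.liftPath γ' (g 0) e1 :=
    (cov.eq_liftPath_iff' e1).2 ⟨funext fun s => hg s, rfl⟩
  have hd' : d = cov.liftPath δ' (g 0) e2 :=
    (cov.eq_liftPath_iff' e2).2 ⟨funext fun s => hd s, h0.symm⟩
  rwa [← hg', ← hd'] at this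

theorem Homotopic.apply_zero {γ δ : Curve} (h : Homotopic γ δ) : γ 0 = δ 0 := by
  obtain ⟨H⟩ := h
  rw [← H.eq_fst 0 (by simp : (0 : I) ∈ ({0, 1} : Set I)),
    ← H.eq_snd 0 (by simp : (0 : I) ∈ ({0, 1} : Set I))]

theorem Homotopic.apply_one {γ δ : Curve} (h : Homotopic γ δ) : γ 1 = δ 1 := by
  obtain ⟨H⟩ := h
  rw [← H.eq_fst 0 (by simp : (1 : I) ∈ ({0, 1} : Set I)),
    ← H.eq_snd 0 (by simp : (1 : I) ∈ ({0, 1} : Set I))]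

/-- Curves with lifts that have the same endpoints are homotopic. -/
theorem homotopic_of_lifts {γ δ : Curve} {g d : C(I, ℝ)} (hg : Lifts γ g) (hd : Lifts δ d)
    (h0 : g 0 = d 0) (h1 : g 1 = d 1) (k0 : (γ 0).2 = (δ 0).2) (k1 : (γ 1).2 = (δ 1).2) :
    Homotopic γ δ := by
  have hmem : ∀ t x y : I, (1 - (t : ℝ)) * x + t * y ∈ I := fun t x y =>
    convex_Icc (0 : ℝ) 1 x.2 y.2 (by linarith [t.2.2]) t.2.1 (by ring)
  have hcoe : Continuous (fun x : ℝ => (x : UnitAddCircle)) := AddCircle.continuous_mk' 1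
  -- The homotopy is the straight-line homotopy between the lifts in the convex strip, projected to
  -- the annulus.
  refine ⟨⟨⟨⟨fun p => ((((1 - (p.1 : ℝ)) * g p.2 + p.1 * d p.2 : ℝ) : UnitAddCircle),
    ⟨(1 - (p.1 : ℝ)) * (γ p.2).2 + p.1 * (δ p.2).2, hmem _ _ _⟩), ?_⟩, ?_, ?_⟩, ?_⟩⟩
  · exact (hcoe.comp (by fun_prop)).prodMk (Continuous.subtype_mk (by fun_prop) _)
  · intro s
    refine Prod.ext ?_ (Subtype.ext ?_)
    · simpa using hg s
    · simp
  · intro s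
    refine Prod.ext ?_ (Subtype.ext ?_)
    · simpa using hd s
    · simp
  · intro t s hs
    have hgs : g s = d s ∧ (γ s).2 = (δ s).2 := by
      rcases hs with rfl | hs
      · exact ⟨h0, k0⟩
      · rw [Set.mem_singleton_iff] at hs
        subst hs
        exact ⟨h1, k1⟩
    refine Prod.ext ?_ (Subtype.ext ?_)
    · change (((1 - (t : ℝ)) * g s + t * d s : ℝ) : UnitAddCircle) = (γ s).1
      rw [← hgs.1, ← hg s]
      congr 1
      ring
    · change (1 - (t : ℝ)) * (γ s).2 + t * (δ s).2 = ((γ s).2 : ℝ)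
      rw [← hgs.2]
      ring

/-! ### Segments represent arcs -/

/-- A monotone enumeration of the lifts of the points of `A`. -/
structure Enum (A : Finset UnitAddCircle) (n : ℤ) where
  /-- the `j`-th point -/
  pt : ℤ → ℝ
  mono : StrictMono pt
  add_period : ∀ j, pt (j + n) = pt j + 1
  mem_iff : ∀ x : ℝ, (x : UnitAddCircle) ∈ A ↔ ∃ j, pt j = x

theorem Enum.add_mul {A : Finset UnitAddCircle} {n : ℤ} (P : Enum A n) (j k : ℤ) :
    P.pt (j + k * n) = P.pt j + k := by
  induction k using Int.induction_on with
  | zero => simp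
  | succ k ih =>
    rw [show j + (k + 1) * n = j + k * n + n by ring, P.add_period, ih]
    push_cast
    ring
  | pred k ih =>
    have := P.add_period (j + (-k - 1) * n)
    rw [show j + (-k - 1) * n + n = j + -k * n by ring, ih] at this
    push_cast at *
    linarith

namespace Seg

variable {A B : Finset UnitAddCircle} {n m : ℤ} (P : Enum A n) (Q : Enum B m)

/-- The first endpoint of a segment, in the strip. -/
def src : Seg → ℝ × ℝ
  | outer a _ => (P.pt a, 1)
  | inner a _ => (Q.pt a, 0)
  | bridge a _ => (P.pt a, 1)

/-- The second endpoint of a segment, in the strip. -/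
def tgt : Seg → ℝ × ℝ
  | outer _ b => (P.pt b, 1)
  | inner _ b => (Q.pt b, 0)
  | bridge _ b => (Q.pt b, 0)

theorem src_shift (k : ℤ) (p : Seg) :
    src P Q (shift n m k p) = ((src P Q p).1 + k, (src P Q p).2) := by
  cases p <;> simp only [src, shift, Enum.add_mul]

theorem tgt_shift (k : ℤ) (p : Seg) :
    tgt P Q (shift n m k p) = ((tgt P Q p).1 + k, (tgt P Q p).2) := by
  cases p <;> simp only [tgt, shift, Enum.add_mul]

/-- The curve `γ` runs along the arc with lift `p`, in the direction of `p`. -/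
def Directs (γ : Curve) (p : Seg) : Prop :=
  ∃ g, Lifts γ g ∧ ((g 0, ((γ 0).2 : ℝ)) = src P Q p) ∧ ((g 1, ((γ 1).2 : ℝ)) = tgt P Q p)

/-- The curve `γ` runs along the arc with lift `p`, in one of the directions. -/
def Represents (γ : Curve) (p : Seg) : Prop := Directs P Q γ p ∨ Directs P Q γ.reverse p

variable {P Q}

theorem Directs.homotopic {γ δ : Curve} {p : Seg} (hγ : Directs P Q γ p) (hδ : Directs P Q δ p) :
    Homotopic γ δ := by
  obtain ⟨g, hg, h0, h1⟩ := hγ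
  obtain ⟨d, hd, k0, k1⟩ := hδ
  have e0 := h0.trans k0.symm
  have e1 := h1.trans k1.symm
  rw [Prod.mk.injEq] at e0 e1
  exact homotopic_of_lifts hg hd e0.1 e1.1 (Subtype.ext e0.2) (Subtype.ext e1.2)

theorem Directs.of_homotopic {γ δ : Curve} {p : Seg} (hγ : Directs P Q γ p)
    (h : Homotopic γ δ) : Directs P Q δ p := by
  obtain ⟨g, hg, h0, h1⟩ := hγ
  obtain ⟨d, hd, k0⟩ := exists_lift δ (x := g 0) (by rw [hg 0, h.apply_zero])
  refine ⟨d, hd, ?_, ?_⟩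
  · rw [k0, ← h.apply_zero, h0]
  · rw [← h.lift_one_eq hg hd k0.symm, ← h.apply_one, h1]

theorem Represents.sameArc {γ δ : Curve} {p : Seg} (hγ : Represents P Q γ p)
    (hδ : Represents P Q δ p) : SameArc γ δ := by
  rcases hγ with hγ | hγ <;> rcases hδ with hδ | hδ
  · exact Or.inl (hγ.homotopic hδ)
  · exact Or.inr (hγ.homotopic hδ)
  · have := (hγ.homotopic hδ).reverse
    rw [reverse_reverse] at this
    exact Or.inr this
  · have := (hγ.homotopic hδ).reverse
    rw [reverse_reverse, reverse_reverse] at this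
    exact Or.inl this

theorem Represents.of_sameArc {γ δ : Curve} {p : Seg} (hγ : Represents P Q γ p)
    (h : SameArc γ δ) : Represents P Q δ p := by
  rcases hγ with hγ | hγ <;> rcases h with h | h
  · exact Or.inl (hγ.of_homotopic h)
  · exact Or.inr (hγ.of_homotopic h)
  · exact Or.inr (hγ.of_homotopic h.reverse)
  · have := h.reverse
    rw [reverse_reverse] at this
    exact Or.inl (hγ.of_homotopic this)

theorem Directs.shift {γ : Curve} {p : Seg} (hγ : Directs P Q γ p) (k : ℤ) :
    Directs P Q γ (shift n m k p) := by
  obtain ⟨g, hg, h0, h1⟩ := hγ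
  refine ⟨_, hg.add_int k, ?_, ?_⟩
  · rw [src_shift, ← h0]
    rfl
  · rw [tgt_shift, ← h1]
    rfl

theorem Represents.shift {γ : Curve} {p : Seg} (hγ : Represents P Q γ p) (k : ℤ) :
    Represents P Q γ (shift n m k p) := hγ.imp (·.shift k) (·.shift k)

theorem lifts_differ {γ : Curve} {g d : C(I, ℝ)} (hg : Lifts γ g) (hd : Lifts γ d) :
    ∃ k : ℤ, d 0 = g 0 + k ∧ d 1 = g 1 + k := by
  obtain ⟨k, hk⟩ := coe_eq_coe_iff_exists_int.1 ((hd 0).trans (hg 0).symm)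
  exact ⟨k, hk, Homotopic.lift_one_eq (ContinuousMap.HomotopicRel.refl γ) hd (hg.add_int k) hk⟩

/-- Two lifts of one curve differ by an integer translation, which is a deck transformation, and a
segment is determined by its two endpoints. -/
theorem Directs.eq_shift {γ : Curve} {p q : Seg} (hp : Directs P Q γ p) (hq : Directs P Q γ q) :
    ∃ k, q = Seg.shift n m k p := by
  obtain ⟨g, hg, h0, h1⟩ := hp
  obtain ⟨d, hd, k0, k1⟩ := hq
  obtain ⟨k, e0, e1⟩ := lifts_differ hg hd
  refine ⟨k, ?_⟩
  have s0 : src P Q q = src P Q (Seg.shift n m k p) := by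
    rw [src_shift, ← h0, ← k0, e0]
  have s1 : tgt P Q q = tgt P Q (Seg.shift n m k p) := by
    rw [tgt_shift, ← h1, ← k1, e1]
  generalize Seg.shift n m k p = r at s0 s1
  cases q <;> cases r <;> simp [src, tgt, P.mono.injective.eq_iff, Q.mono.injective.eq_iff] at s0 s1
  all_goals simp [s0, s1]

/-- Admissible segments carry a preferred direction: rightwards on a boundary line, and from the
outer to the inner line for bridges. A curve and its reverse cannot both follow it. -/
theorem Directs.not_reverse {γ : Curve} {p q : Seg} (hp : Directs P Q γ p)
    (hq : Directs P Q γ.reverse q) (ap : Adm n m p) (aq : Adm n m q) : False := by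
  obtain ⟨g, hg, h0, h1⟩ := hp
  obtain ⟨d, hd, k0, k1⟩ := hq
  have hd' := hd.reverse
  rw [reverse_reverse] at hd'
  obtain ⟨k, e0, e1⟩ := lifts_differ hg hd'
  simp only [ContinuousMap.comp_apply, ContinuousMap.coe_mk, symm_zero, symm_one] at e0 e1
  have s0 : tgt P Q q = src P Q (Seg.shift n m k p) := by
    rw [src_shift, ← h0, ← k1, e0]
    simp [Curve.reverse]
  have s1 : src P Q q = tgt P Q (Seg.shift n m k p) := by
    rw [tgt_shift, ← h1, ← k0, e1]
    simp [Curve.reverse]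
  have ar := (adm_shift n m k p).2 ap
  generalize Seg.shift n m k p = r at s0 s1 ar
  cases q <;> cases r <;>
    simp [src, tgt, Adm, P.mono.injective.eq_iff, Q.mono.injective.eq_iff] at s0 s1 ar aq
  all_goals omega

theorem Represents.eq_shift {γ : Curve} {p q : Seg} (hp : Represents P Q γ p)
    (hq : Represents P Q γ q) (ap : Adm n m p) (aq : Adm n m q) :
    ∃ k, q = Seg.shift n m k p := by
  rcases hp with hp | hp <;> rcases hq with hq | hq
  · exact hp.eq_shift hq
  · exact (hp.not_reverse hq ap aq).elim
  · exact (hq.not_reverse hp aq ap).elim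
  · exact hp.eq_shift hq

/-- The twist lifts to the shear that adds `1 - t` at height `t`. It fixes the outer line and moves
the inner one by a full period, which is `m` labels. -/
theorem Directs.map_dehnTwist {γ : Curve} {p : Seg} (h : Directs P Q γ p) :
    Directs P Q (γ.map dehnTwist) (twist m 1 p) := by
  obtain ⟨g, hg, h0, h1⟩ := h
  refine ⟨⟨fun s => g s + (1 - ((γ s).2 : ℝ)), by fun_prop⟩, fun s => ?_, ?_, ?_⟩
  · change ((g s + (1 - ((γ s).2 : ℝ)) : ℝ) : UnitAddCircle) = (dehnTwist (γ s)).1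
    rw [AddCircle.coe_add, hg s]
    rfl
  · change (g 0 + (1 - ((γ 0).2 : ℝ)), ((γ 0).2 : ℝ)) = _
    cases p <;> simp only [src, Prod.mk.injEq] at h0 <;> rw [h0.1, h0.2] <;>
      simp [src, twist, ← Q.add_period]
  · change (g 1 + (1 - ((γ 1).2 : ℝ)), ((γ 1).2 : ℝ)) = _
    cases p <;> simp only [tgt, Prod.mk.injEq] at h1 <;> rw [h1.1, h1.2] <;>
      simp [tgt, twist, ← Q.add_period]

theorem Represents.map_dehnTwist {γ : Curve} {p : Seg} (h : Represents P Q γ p) :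
    Represents P Q (γ.map dehnTwist) (twist m 1 p) :=
  h.imp Directs.map_dehnTwist Directs.map_dehnTwist

end Seg

end Annulus

/-! ### Interleaving endpoints force lifts to meet -/

namespace Annulus

open unitInterval

namespace Seg

variable {A B : Finset UnitAddCircle} {n m : ℤ} {P : Enum A n} {Q : Enum B m}

theorem Cross.endpoints_ne {p q : Seg} (h : Cross p q) :
    src P Q p ≠ src P Q q ∧ src P Q p ≠ tgt P Q q ∧ tgt P Q p ≠ src P Q q ∧
      tgt P Q p ≠ tgt P Q q := by
  cases p <;> cases q <;> simp only [Cross, ChordCross] at h <;>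
    simp [src, tgt, P.mono.injective.eq_iff, Q.mono.injective.eq_iff] <;> omega

/-- The lifts of two curves meet if their endpoints interleave. -/
theorem Cross.exists_meet {x y x' y' : C(I, ℝ)} (hy : ∀ s, y s ∈ Set.Icc (0 : ℝ) 1)
    (hy' : ∀ s, y' s ∈ Set.Icc (0 : ℝ) 1) {p q : Seg}
    (h0 : (x 0, y 0) = src P Q p) (h1 : (x 1, y 1) = tgt P Q p)
    (h0' : (x' 0, y' 0) = src P Q q) (h1' : (x' 1, y' 1) = tgt P Q q) (h : Cross p q) :
    ∃ s t, x s = x' t ∧ y s = y' t := by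
  -- Half of the crossing patterns are settled directly. The others become direct after exchanging
  -- the two curves, and the final disjunction records enough to show that a pattern cannot be
  -- deferred twice.
  have main : ∀ {x y x' y' : C(I, ℝ)}, (∀ s, y s ∈ Set.Icc (0 : ℝ) 1) →
      (∀ s, y' s ∈ Set.Icc (0 : ℝ) 1) → ∀ {p q : Seg}, (x 0, y 0) = src P Q p →
      (x 1, y 1) = tgt P Q p → (x' 0, y' 0) = src P Q q → (x' 1, y' 1) = tgt P Q q → Cross p q →
      (∃ s t, x s = x' t ∧ y s = y' t) ∨ Cross q p ∧ ¬ (∃ s t, x s = x' t ∧ y s = y' t) ∧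
        ((∃ a b c d, p = outer a b ∧ q = outer c d ∧ c < a) ∨
        (∃ a b c d, p = inner a b ∧ q = inner c d ∧ c < a) ∨
        (∃ a b c d, p = bridge a b ∧ q = bridge c d ∧ c < a) ∨
        (∃ a b c d, p = bridge a b ∧ q = outer c d) ∨
        (∃ a b c d, p = bridge a b ∧ q = inner c d)) := by
    intro x y x' y' hy hy' p q h0 h1 h0' h1' h
    by_cases hmeet : ∃ s t, x s = x' t ∧ y s = y' t
    · exact Or.inl hmeet
    have hflip : ∀ {y : C(I, ℝ)}, (∀ s, y s ∈ Set.Icc (0 : ℝ) 1) →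
        ∀ s, (⟨fun s => 1 - y s, by fun_prop⟩ : C(I, ℝ)) s ∈ Set.Icc (0 : ℝ) 1 :=
      fun hy s => ⟨sub_nonneg.2 (hy s).2, sub_le_self 1 (hy s).1⟩
    have hunflip : (∃ s t, x s = x' t ∧ (⟨fun s => 1 - y s, by fun_prop⟩ : C(I, ℝ)) s =
        (⟨fun s => 1 - y' s, by fun_prop⟩ : C(I, ℝ)) t) → False := by
      rintro ⟨s, t, e1, e2⟩
      exact hmeet ⟨s, t, e1, sub_right_injective e2⟩
    rcases p with ⟨a, b⟩ | ⟨a, b⟩ | ⟨a, b⟩ <;> rcases q with ⟨c, d⟩ | ⟨c, d⟩ | ⟨c, d⟩ <;>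
      simp only [src, tgt, Prod.mk.injEq] at h0 h1 h0' h1' <;>
      simp only [Cross, ChordCross] at h
    · rcases h with h | h
      · refine (hmeet (exists_meet_of_interleave hy hy' h0.2 h1.2 h0'.2 h1'.2 ?_ ?_ ?_)).elim <;>
          simp only [h0.1, h1.1, h0'.1, h1'.1] <;> exact P.mono (by omega)
      · exact Or.inr ⟨Or.inl h, hmeet, Or.inl ⟨a, b, c, d, rfl, rfl, h.1⟩⟩
    · refine (hmeet (exists_meet_of_between hy hy' h0.2 h1.2 h0'.2 h1'.2 ?_ ?_)).elim <;>
          simp only [h0.1, h1.1, h0'.1] <;> exact P.mono (by omega)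
    · rcases h with h | h
      · refine (hunflip (exists_meet_of_interleave (hflip hy) (hflip hy') ?_ ?_ ?_ ?_
          ?_ ?_ ?_)).elim <;>
          simp only [h0, h1, h0', h1', ContinuousMap.coe_mk, sub_zero] <;> exact Q.mono (by omega)
      · exact Or.inr ⟨Or.inl h, hmeet, Or.inr (Or.inl ⟨a, b, c, d, rfl, rfl, h.1⟩)⟩
    · exfalso
      -- The strip is turned upside down, so that the inner arc has its ends on the upper line. The
      -- bridge is reversed to start there too.
      have hrev := exists_meet_of_between (hflip hy)
        (y' := (⟨fun s => 1 - y' (σ s), by fun_prop⟩ : C(I, ℝ)))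
        (x' := (⟨fun s => x' (σ s), by fun_prop⟩ : C(I, ℝ))) (fun s => hflip hy' (σ s))
        (x := x) (by simp [h0]) (by simp [h1]) (by simp [h1']) (by simp [h0'])
        (by simpa [h0, h1'] using Q.mono h.1) (by simpa [h1, h1'] using Q.mono h.2)
      obtain ⟨s, t, e1, e2⟩ := hrev
      exact hunflip ⟨s, σ t, e1, e2⟩
    · exact Or.inr ⟨h, hmeet, Or.inr (Or.inr (Or.inr (Or.inl ⟨a, b, c, d, rfl, rfl⟩)))⟩
    · exact Or.inr ⟨h, hmeet, Or.inr (Or.inr (Or.inr (Or.inr ⟨a, b, c, d, rfl, rfl⟩)))⟩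
    · rcases h with h | h
      · refine (hmeet (exists_meet_of_opposite hy hy' h0.2 h1.2 h0'.2 h1'.2 ?_ ?_)).elim <;>
          simp only [h0.1, h1.1, h0'.1, h1'.1]
        exacts [P.mono h.1, Q.mono h.2]
      · exact Or.inr ⟨Or.inl h, hmeet, Or.inr (Or.inr (Or.inl ⟨a, b, c, d, rfl, rfl, h.1⟩))⟩
  rcases main hy hy' h0 h1 h0' h1' h with h2 | ⟨h2, hno, h3⟩
  · exact h2
  · rcases main hy' hy h0' h1' h0 h1 h2 with ⟨s, t, e1, e2⟩ | ⟨-, -, h4⟩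
    · exact ⟨t, s, e1.symm, e2.symm⟩
    · exfalso
      rcases h3 with ⟨a, b, c, d, rfl, rfl, h3⟩ | ⟨a, b, c, d, rfl, rfl, h3⟩ |
        ⟨a, b, c, d, rfl, rfl, h3⟩ | ⟨a, b, c, d, rfl, rfl⟩ | ⟨a, b, c, d, rfl, rfl⟩ <;>
        simp at h4 <;> omega

end Seg

end Annulus

/-! ### From curves to admissible segments -/

namespace Annulus

open unitInterval

theorem eq_zero_or_one_of_not_mem_Ioo {s : I} (hs : s ∉ Set.Ioo (0 : I) 1) : s = 0 ∨ s = 1 := by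
  by_contra! h
  exact hs ⟨lt_of_le_of_ne s.2.1 fun e => h.1 e.symm,
    lt_of_le_of_ne s.2.2 fun e => h.2 e⟩

theorem symm_mem_Ioo {s : I} (hs : s ∈ Set.Ioo (0 : I) 1) : σ s ∈ Set.Ioo (0 : I) 1 := by
  by_contra h
  rcases eq_zero_or_one_of_not_mem_Ioo h with h | h
  · rw [symm_eq_zero] at h
    exact hs.2.ne h
  · rw [symm_eq_one] at h
    exact hs.1.ne' h

/-- The height is constant along a curve in the boundary. -/
theorem height_eq_of_isBoundary {δ : Curve} (hδ : ∀ s, IsBoundary (δ s)) (s t : I) :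
    (δ s).2 = (δ t).2 := by
  have hcont : Continuous fun s => ((δ s).2 : ℝ) := by fun_prop
  have hoc := (isPreconnected_range hcont).ordConnected
  have hno : ∀ s t, (δ s).2 = 0 → (δ t).2 = 1 → False := by
    intro s t hs ht
    obtain ⟨r, hr⟩ := hoc.out (Set.mem_range_self s) (Set.mem_range_self t)
      (show (1 / 2 : ℝ) ∈ Set.Icc ((δ s).2 : ℝ) (δ t).2 by rw [hs, ht]; norm_num)
    have hr' : ((δ r).2 : ℝ) = 1 / 2 := hr
    rcases hδ r with h | h <;> rw [h] at hr' <;> norm_num at hr'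
  rcases hδ s with hs | hs <;> rcases hδ t with ht | ht
  · rw [hs, ht]
  · exact (hno s t hs ht).elim
  · exact (hno t s ht hs).elim
  · rw [hs, ht]

theorem IsBoundaryParallel.reverse {A B : Finset UnitAddCircle} {γ : Curve}
    (h : IsBoundaryParallel A B γ) : IsBoundaryParallel A B γ.reverse := by
  obtain ⟨δ, h1, h2, h3⟩ := h
  exact ⟨δ.reverse, h1.reverse, fun s => h2 (σ s), fun s hs => h3 (σ s) (symm_mem_Ioo hs)⟩

theorem IsArcCurve.reverse {A B : Finset UnitAddCircle} {γ : Curve} (h : IsArcCurve A B γ) :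
    IsArcCurve A B γ.reverse where
  marked_zero := by simpa [Curve.reverse] using h.marked_one
  marked_one := by simpa [Curve.reverse] using h.marked_zero
  interior s hs := h.interior (σ s) (symm_mem_Ioo hs)
  simple s hs t ht e := symm_bijective.injective
    (h.simple (symm_mem_Ioo hs) (symm_mem_Ioo ht) e)
  essential hb := h.essential (by simpa [reverse_reverse] using hb.reverse)

namespace Seg

variable {A B : Finset UnitAddCircle} {n m : ℤ} {P : Enum A n} {Q : Enum B m}

theorem src_height (p : Seg) : (src P Q p).2 = 0 ∨ (src P Q p).2 = 1 := by
  cases p <;> simp [src]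

theorem tgt_height (p : Seg) : (tgt P Q p).2 = 0 ∨ (tgt P Q p).2 = 1 := by
  cases p <;> simp [tgt]

theorem isBoundary_of_height {z : Annulus} (h : (z.2 : ℝ) = 0 ∨ (z.2 : ℝ) = 1) : IsBoundary z :=
  h.imp Subtype.ext Subtype.ext

/-- Curves whose endpoints interleave meet in the interior of the annulus. -/
theorem Cross.exists_meet_interior {γ δ : Curve} {g d : C(I, ℝ)}
    (iγ : ∀ s ∈ Set.Ioo (0 : I) 1, ¬ IsBoundary (γ s))
    (iδ : ∀ s ∈ Set.Ioo (0 : I) 1, ¬ IsBoundary (δ s)) (hg : Lifts γ g) (hd : Lifts δ d) {p q : Seg}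
    (h0 : (g 0, ((γ 0).2 : ℝ)) = src P Q p) (h1 : (g 1, ((γ 1).2 : ℝ)) = tgt P Q p)
    (h0' : (d 0, ((δ 0).2 : ℝ)) = src P Q q) (h1' : (d 1, ((δ 1).2 : ℝ)) = tgt P Q q)
    (h : Cross p q) :
    ∃ s ∈ Set.Ioo (0 : I) 1, ∃ t ∈ Set.Ioo (0 : I) 1, g s = d t ∧ γ s = δ t := by
  obtain ⟨s, t, e1, e2⟩ := h.exists_meet (P := P) (Q := Q) (x := g) (x' := d)
    (y := ⟨fun s => ((γ s).2 : ℝ), by fun_prop⟩) (y' := ⟨fun s => ((δ s).2 : ℝ), by fun_prop⟩)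
    (fun s => (γ s).2.2) (fun s => (δ s).2.2) h0 h1 h0' h1'
  have e2 : ((γ s).2 : ℝ) = (δ t).2 := e2
  have e : γ s = δ t := Prod.ext (by rw [← hg s, ← hd t, e1]) (Subtype.ext e2)
  have bd : ∀ {γ : Curve} {g : C(I, ℝ)} {p : Seg}, (g 0, ((γ 0).2 : ℝ)) = src P Q p →
      (g 1, ((γ 1).2 : ℝ)) = tgt P Q p → ∀ s : I, (s = 0 ∨ s = 1) → IsBoundary (γ s) := by
    intro γ g p h0 h1 s hs
    apply isBoundary_of_height
    rcases hs with rfl | rfl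
    · have := src_height (P := P) (Q := Q) p
      rwa [← h0] at this
    · have := tgt_height (P := P) (Q := Q) p
      rwa [← h1] at this
  have hne := h.endpoints_ne (P := P) (Q := Q)
  rw [← h0, ← h1, ← h0', ← h1'] at hne
  -- Crossing segments share no endpoint, so the meeting point is not an end of both curves. It is
  -- not an end of just one, since ends lie on the boundary and interior points do not.
  have key : ¬ ((s = 0 ∨ s = 1) ∧ (t = 0 ∨ t = 1)) := by
    rintro ⟨rfl | rfl, rfl | rfl⟩
    · exact hne.1 (Prod.ext e1 e2)
    · exact hne.2.1 (Prod.ext e1 e2)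
    · exact hne.2.2.1 (Prod.ext e1 e2)
    · exact hne.2.2.2 (Prod.ext e1 e2)
  have hs : s ∈ Set.Ioo (0 : I) 1 := by
    by_contra hs
    have hs' := eq_zero_or_one_of_not_mem_Ioo hs
    by_cases ht : t ∈ Set.Ioo (0 : I) 1
    · exact iδ t ht (e ▸ bd h0 h1 s hs')
    · exact key ⟨hs', eq_zero_or_one_of_not_mem_Ioo ht⟩
  refine ⟨s, hs, t, ?_, e1, e⟩
  by_contra ht
  exact iγ s hs (e ▸ bd h0' h1' t (eq_zero_or_one_of_not_mem_Ioo ht))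

theorem Directs.exists_meet {γ δ : Curve} (iγ : ∀ s ∈ Set.Ioo (0 : I) 1, ¬ IsBoundary (γ s))
    (iδ : ∀ s ∈ Set.Ioo (0 : I) 1, ¬ IsBoundary (δ s)) {p q : Seg} (hp : Directs P Q γ p)
    (hq : Directs P Q δ q) (h : Cross p q) :
    ∃ s ∈ Set.Ioo (0 : I) 1, ∃ t ∈ Set.Ioo (0 : I) 1, γ s = δ t := by
  obtain ⟨g, hg, h0, h1⟩ := hp
  obtain ⟨d, hd, k0, k1⟩ := hq
  obtain ⟨s, hs, t, ht, -, e⟩ := h.exists_meet_interior iγ iδ hg hd h0 h1 k0 k1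
  exact ⟨s, hs, t, ht, e⟩

theorem Represents.exists_meet {γ δ : Curve} (hγ : IsArcCurve A B γ) (hδ : IsArcCurve A B δ)
    {p q : Seg} (hp : Represents P Q γ p) (hq : Represents P Q δ q) (h : PeriodicCross n m p q) :
    ∃ s ∈ Set.Ioo (0 : I) 1, ∃ t ∈ Set.Ioo (0 : I) 1, γ s = δ t := by
  obtain ⟨k, h⟩ := h
  rcases hp with hp | hp <;> rcases hq.shift k with hq | hq
  · exact hp.exists_meet hγ.interior hδ.interior hq h
  · obtain ⟨s, hs, t, ht, e⟩ := hp.exists_meet hγ.interior hδ.reverse.interior hq h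
    exact ⟨s, hs, σ t, symm_mem_Ioo ht, e⟩
  · obtain ⟨s, hs, t, ht, e⟩ := hp.exists_meet hγ.reverse.interior hδ.interior hq h
    exact ⟨σ s, symm_mem_Ioo hs, t, ht, e⟩
  · obtain ⟨s, hs, t, ht, e⟩ := hp.exists_meet hγ.reverse.interior hδ.reverse.interior hq h
    exact ⟨σ s, symm_mem_Ioo hs, σ t, symm_mem_Ioo ht, e⟩

/-- If a lift met its translate by `k`, simplicity of the curve would make the two parameters equal,
hence `k = 0`. Applied to `k = 1`, this bounds the length of an arc on one boundary circle by a full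
turn. -/
theorem Directs.not_cross_shift {γ : Curve} (hγ : IsArcCurve A B γ) {p : Seg}
    (hp : Directs P Q γ p) {k : ℤ} (hk : k ≠ 0) : ¬ Cross p (Seg.shift n m k p) := by
  intro h
  obtain ⟨g, hg, h0, h1⟩ := hp
  obtain ⟨s, hs, t, ht, e1, e⟩ := h.exists_meet_interior (P := P) (Q := Q) hγ.interior hγ.interior hg
    (hg.add_int k) h0 h1 (by rw [src_shift, ← h0]; rfl) (by rw [tgt_shift, ← h1]; rfl)
  have := hγ.simple hs ht e
  subst this
  simp at e1
  exact hk e1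

end Seg

theorem isMarked_one {A B : Finset UnitAddCircle} (x : UnitAddCircle) :
    IsMarked A B (x, 1) ↔ x ∈ A := by
  simp [IsMarked]

theorem isMarked_zero {A B : Finset UnitAddCircle} (x : UnitAddCircle) :
    IsMarked A B (x, 0) ↔ x ∈ B := by
  simp [IsMarked]

/-- The endpoints of an arc on one boundary circle are not neighbours in the universal cover. -/
theorem IsArcCurve.add_two_le {A B C : Finset UnitAddCircle} {N : ℤ} (R : Enum C N) {e : I}
    (he : e = 0 ∨ e = 1) (hmark : ∀ x, IsMarked A B (x, e) ↔ x ∈ C) {γ : Curve}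
    (hγ : IsArcCurve A B γ) {g : C(I, ℝ)} (hg : Lifts γ g) {a b : ℤ} (h0 : g 0 = R.pt a)
    (h1 : g 1 = R.pt b) (k0 : (γ 0).2 = e) (k1 : (γ 1).2 = e) (hab : a ≤ b) : a + 2 ≤ b := by
  by_contra hb
  have hlt : R.pt a < R.pt (a + 1) := R.mono (by omega)
  have hcoe : Continuous (fun x : ℝ => (x : UnitAddCircle)) := AddCircle.continuous_mk' 1
  -- If `b ≤ a + 1`, the curve can be pushed into the boundary: along one edge when `b = a + 1`, and
  -- part of the way along an edge and back when `a = b`.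
  have hd : ∃ d : C(I, ℝ), d 0 = R.pt a ∧ d 1 = R.pt b ∧
      ∀ s ∈ Set.Ioo (0 : I) 1, R.pt a < d s ∧ d s < R.pt (a + 1) := by
    by_cases hab' : a = b
    · subst hab'
      refine ⟨⟨fun s => R.pt a + s * (1 - s) * (R.pt (a + 1) - R.pt a), by fun_prop⟩, by simp,
        by simp, fun s hs => ?_⟩
      have hs0 : (0 : ℝ) < s := hs.1
      have hs1 : (s : ℝ) < 1 := hs.2
      simp only [ContinuousMap.coe_mk]
      have h2 : (0 : ℝ) < s * (1 - s) := mul_pos hs0 (by linarith)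
      have h3 : (s : ℝ) * (1 - s) < 1 := by nlinarith
      constructor <;> nlinarith
    · obtain rfl : b = a + 1 := by omega
      refine ⟨⟨fun s => R.pt a + s * (R.pt (a + 1) - R.pt a), by fun_prop⟩, by simp,
        by simp, fun s hs => ?_⟩
      have hs0 : (0 : ℝ) < s := hs.1
      have hs1 : (s : ℝ) < 1 := hs.2
      simp only [ContinuousMap.coe_mk]
      constructor <;> nlinarith
  obtain ⟨d, hd0, hd1, hdI⟩ := hd
  let δ : Curve := ⟨fun s => (((d s : ℝ) : UnitAddCircle), e),
    (hcoe.comp d.continuous).prodMk continuous_const⟩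
  have hδ : Lifts δ d := fun s => rfl
  refine hγ.essential ⟨δ, homotopic_of_lifts hg hδ (h0.trans hd0.symm) (h1.trans hd1.symm) k0 k1,
    fun s => he, fun s hs hm => ?_⟩
  obtain ⟨j, hj⟩ := (R.mem_iff _).1 ((hmark _).1 hm)
  have := hdI s hs
  rw [← hj, R.mono.lt_iff_lt, R.mono.lt_iff_lt] at this
  omega

namespace Seg

variable {A B : Finset UnitAddCircle} {n m : ℤ} {P : Enum A n} {Q : Enum B m}

theorem exists_directs_outer (hn : 1 ≤ n) {γ : Curve} (hγ : IsArcCurve A B γ) {g : C(I, ℝ)}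
    (hg : Lifts γ g) {a b : ℤ} (h0 : g 0 = P.pt a) (h1 : g 1 = P.pt b) (k0 : (γ 0).2 = 1)
    (k1 : (γ 1).2 = 1) (hab : a ≤ b) : ∃ p, Adm n m p ∧ Directs P Q γ p := by
  have hd : Directs P Q γ (outer a b) := ⟨g, hg, by simp [src, h0, k0], by simp [tgt, h1, k1]⟩
  refine ⟨outer a b, ⟨hγ.add_two_le P (Or.inr rfl) isMarked_one hg h0 h1 k0 k1 hab, ?_⟩, hd⟩
  have := hd.not_cross_shift hγ one_ne_zero
  simp only [Cross, Seg.shift, ChordCross] at this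
  omega

theorem exists_directs_inner (hm : 1 ≤ m) {γ : Curve} (hγ : IsArcCurve A B γ) {g : C(I, ℝ)}
    (hg : Lifts γ g) {a b : ℤ} (h0 : g 0 = Q.pt a) (h1 : g 1 = Q.pt b) (k0 : (γ 0).2 = 0)
    (k1 : (γ 1).2 = 0) (hab : a ≤ b) : ∃ p, Adm n m p ∧ Directs P Q γ p := by
  have hd : Directs P Q γ (inner a b) := ⟨g, hg, by simp [src, h0, k0], by simp [tgt, h1, k1]⟩
  refine ⟨inner a b, ⟨hγ.add_two_le Q (Or.inl rfl) isMarked_zero hg h0 h1 k0 k1 hab, ?_⟩, hd⟩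
  have := hd.not_cross_shift hγ one_ne_zero
  simp only [Cross, Seg.shift, ChordCross] at this
  omega

/-- Every arc has a combinatorial description. -/
theorem exists_represents (hn : 1 ≤ n) (hm : 1 ≤ m) {γ : Curve} (hγ : IsArcCurve A B γ) :
    ∃ p, Adm n m p ∧ Represents P Q γ p := by
  obtain ⟨x, hx⟩ := QuotientAddGroup.mk_surjective (γ 0).1
  obtain ⟨g, hg, rfl⟩ := exists_lift γ hx
  have hr := hg.reverse
  have hr0 : (g.comp ⟨σ, continuous_symm⟩ : C(I, ℝ)) 0 = g 1 := by simp
  have hr1 : (g.comp ⟨σ, continuous_symm⟩ : C(I, ℝ)) 1 = g 0 := by simp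
  have e0 : γ.reverse 0 = γ 1 := by simp [Curve.reverse]
  have e1 : γ.reverse 1 = γ 0 := by simp [Curve.reverse]
  have out : ∀ s, (γ s).1 ∈ A → ∃ a, P.pt a = g s := fun s h => (P.mem_iff _).1 (by rwa [hg s])
  have inn : ∀ s, (γ s).1 ∈ B → ∃ a, Q.pt a = g s := fun s h => (Q.mem_iff _).1 (by rwa [hg s])
  rcases hγ.marked_zero with ⟨k0, m0⟩ | ⟨k0, m0⟩ <;>
    rcases hγ.marked_one with ⟨k1, m1⟩ | ⟨k1, m1⟩
  · obtain ⟨a, ha⟩ := out 0 m0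
    obtain ⟨b, hb⟩ := out 1 m1
    rcases le_total a b with hab | hab
    · obtain ⟨p, hp, h⟩ := exists_directs_outer (P := P) (Q := Q) hn hγ hg ha.symm hb.symm k0 k1 hab
      exact ⟨p, hp, Or.inl h⟩
    · obtain ⟨p, hp, h⟩ := exists_directs_outer (P := P) (Q := Q) hn hγ.reverse hr
        (hr0.trans hb.symm) (hr1.trans ha.symm) (by rw [e0, k1]) (by rw [e1, k0]) hab
      exact ⟨p, hp, Or.inr h⟩
  · obtain ⟨a, ha⟩ := out 0 m0
    obtain ⟨b, hb⟩ := inn 1 m1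
    exact ⟨bridge a b, trivial, Or.inl ⟨g, hg, by simp [src, ha, k0], by simp [tgt, hb, k1]⟩⟩
  · obtain ⟨a, ha⟩ := inn 0 m0
    obtain ⟨b, hb⟩ := out 1 m1
    exact ⟨bridge b a, trivial, Or.inr ⟨_, hr, by rw [e0, hr0]; simp [src, hb, k1],
      by rw [e1, hr1]; simp [tgt, ha, k0]⟩⟩
  · obtain ⟨a, ha⟩ := inn 0 m0
    obtain ⟨b, hb⟩ := inn 1 m1
    rcases le_total a b with hab | hab
    · obtain ⟨p, hp, h⟩ := exists_directs_inner (P := P) (Q := Q) hm hγ hg ha.symm hb.symm k0 k1 hab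
      exact ⟨p, hp, Or.inl h⟩
    · obtain ⟨p, hp, h⟩ := exists_directs_inner (P := P) (Q := Q) hm hγ.reverse hr
        (hr0.trans hb.symm) (hr1.trans ha.symm) (by rw [e0, k1]) (by rw [e1, k0]) hab
      exact ⟨p, hp, Or.inr h⟩

theorem exists_mem_Ioo_eq {d : C(I, ℝ)} {x : ℝ} (h0 : d 0 < x) (h1 : x < d 1) :
    ∃ s ∈ Set.Ioo (0 : I) 1, d s = x := by
  obtain ⟨s, hs⟩ := (isPreconnected_range d.continuous).ordConnected.out (Set.mem_range_self 0)
    (Set.mem_range_self 1) ⟨h0.le, h1.le⟩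
  refine ⟨s, ?_, hs⟩
  by_contra h
  rcases eq_zero_or_one_of_not_mem_Ioo h with rfl | rfl
  · exact h0.ne hs
  · exact h1.ne' hs

/-- A curve in the boundary has constant height, which excludes bridges. For other segments, its
lift passes over the marked point numbered `a + 1`, by the intermediate value theorem. -/
theorem Directs.not_isBoundaryParallel {γ : Curve} {p : Seg} (hp : Adm n m p)
    (h : Directs P Q γ p) : ¬ IsBoundaryParallel A B γ := by
  rintro ⟨δ, hδ, hb, hm⟩
  obtain ⟨d, hd, h0, h1⟩ := h.of_homotopic hδ
  have hh := height_eq_of_isBoundary hb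
  cases p with
  | outer a b =>
    simp only [src, tgt, Prod.mk.injEq] at h0 h1
    obtain ⟨s, hs, e⟩ := exists_mem_Ioo_eq (d := d) (x := P.pt (a + 1))
      (by rw [h0.1]; exact P.mono (by omega)) (by rw [h1.1]; exact P.mono (by have := hp.1; omega))
    refine hm s hs (Or.inl ⟨(hh s 0).trans (Subtype.ext h0.2), ?_⟩)
    rw [← hd s, P.mem_iff]
    exact ⟨_, e.symm⟩
  | inner a b =>
    simp only [src, tgt, Prod.mk.injEq] at h0 h1
    obtain ⟨s, hs, e⟩ := exists_mem_Ioo_eq (d := d) (x := Q.pt (a + 1))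
      (by rw [h0.1]; exact Q.mono (by omega)) (by rw [h1.1]; exact Q.mono (by have := hp.1; omega))
    refine hm s hs (Or.inr ⟨(hh s 0).trans (Subtype.ext h0.2), ?_⟩)
    rw [← hd s, Q.mem_iff]
    exact ⟨_, e.symm⟩
  | bridge a b =>
    simp only [src, tgt, Prod.mk.injEq] at h0 h1
    have := h0.2
    rw [hh 0 1, h1.2] at this
    norm_num at this

end Seg

end Annulus

/-! ### Standard curves: noncrossing segments have disjoint representatives -/

namespace Annulus

open unitInterval

namespace Seg

variable {A B : Finset UnitAddCircle} {n m : ℤ} (P : Enum A n) (Q : Enum B m)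

/-- The horizontal coordinate of the standard curve along a segment. The parameter `φ` is the
speed of a curve that crosses the annulus. -/
noncomputable def stdLift (φ : C(I, I)) : Seg → C(I, ℝ)
  | outer a b => ⟨fun s => P.pt a + s * (P.pt b - P.pt a), by fun_prop⟩
  | inner a b => ⟨fun s => Q.pt a + s * (Q.pt b - Q.pt a), by fun_prop⟩
  | bridge a b => ⟨fun s => P.pt a + φ s * (Q.pt b - P.pt a), by fun_prop⟩

/-- The height of the standard curve along a segment. -/
noncomputable def stdHeight : Seg → C(I, I)
  | outer a b => ⟨fun s => Set.projIcc 0 1 zero_le_one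
      (1 - s * (1 - s) * (P.pt b - P.pt a) ^ 2 : ℝ), continuous_projIcc.comp (by fun_prop)⟩
  | inner a b => ⟨fun s => Set.projIcc 0 1 zero_le_one
      (s * (1 - s) * (Q.pt b - Q.pt a) ^ 2 : ℝ), continuous_projIcc.comp (by fun_prop)⟩
  | bridge _ _ => ⟨σ, continuous_symm⟩

/-- The standard curve along a segment. -/
noncomputable def stdCurve (φ : C(I, I)) (p : Seg) : Curve :=
  ⟨fun s => ((stdLift P Q φ p s : UnitAddCircle), stdHeight P Q p s),
    ((AddCircle.continuous_mk' 1).comp (stdLift P Q φ p).continuous).prodMk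
      (stdHeight P Q p).continuous⟩

variable {P Q}

theorem lifts_stdCurve (φ : C(I, I)) (p : Seg) : Lifts (stdCurve P Q φ p) (stdLift P Q φ p) :=
  fun _ => rfl

theorem outer_width {a b : ℤ} (h : Adm n m (outer a b)) :
    0 < P.pt b - P.pt a ∧ P.pt b - P.pt a ≤ 1 := by
  have h1 := h.1
  have h2 := P.mono.monotone h.2
  rw [P.add_period] at h2
  exact ⟨sub_pos.2 (P.mono (by omega)), by linarith⟩

theorem inner_width {a b : ℤ} (h : Adm n m (inner a b)) :
    0 < Q.pt b - Q.pt a ∧ Q.pt b - Q.pt a ≤ 1 := by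
  have h1 := h.1
  have h2 := Q.mono.monotone h.2
  rw [Q.add_period] at h2
  exact ⟨sub_pos.2 (Q.mono (by omega)), by linarith⟩

theorem bump_mem {l : ℝ} (h0 : 0 < l) (h1 : l ≤ 1) (s : I) :
    0 ≤ (s : ℝ) * (1 - s) * l ^ 2 ∧ (s : ℝ) * (1 - s) * l ^ 2 ≤ 1 / 4 := by
  have hs := mul_nonneg s.2.1 (sub_nonneg.2 s.2.2)
  have hs' : (s : ℝ) * (1 - s) ≤ 1 / 4 := by nlinarith [sq_nonneg ((s : ℝ) - 1 / 2)]
  have hl : l ^ 2 ≤ 1 := by nlinarith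
  exact ⟨by positivity, by nlinarith [sq_nonneg l]⟩

theorem bump_pos {l : ℝ} (h0 : 0 < l) {s : I} (hs : s ∈ Set.Ioo (0 : I) 1) :
    0 < (s : ℝ) * (1 - s) * l ^ 2 := by
  have hs0 : (0 : ℝ) < s := hs.1
  have hs1 : (s : ℝ) < 1 := hs.2
  have : (0 : ℝ) < 1 - s := by linarith
  positivity

theorem stdHeight_outer {a b : ℤ} (h : Adm n m (outer a b)) (s : I) :
    (stdHeight P Q (outer a b) s : ℝ) = 1 - s * (1 - s) * (P.pt b - P.pt a) ^ 2 := by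
  obtain ⟨h0, h1⟩ := outer_width (P := P) h
  have := bump_mem h0 h1 s
  simp only [stdHeight, ContinuousMap.coe_mk]
  rw [Set.projIcc_of_mem _ (show _ ∈ Set.Icc (0 : ℝ) 1 from ⟨by linarith, by linarith⟩)]

theorem stdHeight_inner {a b : ℤ} (h : Adm n m (inner a b)) (s : I) :
    (stdHeight P Q (inner a b) s : ℝ) = s * (1 - s) * (Q.pt b - Q.pt a) ^ 2 := by
  obtain ⟨h0, h1⟩ := inner_width (Q := Q) h
  have := bump_mem h0 h1 s
  simp only [stdHeight, ContinuousMap.coe_mk]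
  rw [Set.projIcc_of_mem _ (show _ ∈ Set.Icc (0 : ℝ) 1 from ⟨by linarith, by linarith⟩)]

theorem directs_stdCurve {φ : C(I, I)} (φ0 : φ 0 = 0) (φ1 : φ 1 = 1) {p : Seg} (hp : Adm n m p) :
    Directs P Q (stdCurve P Q φ p) p := by
  refine ⟨_, lifts_stdCurve φ p, Prod.ext ?_ ?_, Prod.ext ?_ ?_⟩
  · cases p <;> simp [stdLift, src, φ0]
  · change (stdHeight P Q p 0 : ℝ) = _
    cases p with
    | outer a b => simp [stdHeight_outer hp, src]
    | inner a b => simp [stdHeight_inner hp, src]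
    | bridge a b => simp [stdHeight, src]
  · cases p <;> simp [stdLift, tgt, φ1]
  · change (stdHeight P Q p 1 : ℝ) = _
    cases p with
    | outer a b => simp [stdHeight_outer hp, tgt]
    | inner a b => simp [stdHeight_inner hp, tgt]
    | bridge a b => simp [stdHeight, tgt]

theorem isMarked_src (p : Seg) {z : Annulus} {x : ℝ} (hx : (x : UnitAddCircle) = z.1)
    (h : (x, (z.2 : ℝ)) = src P Q p) : IsMarked A B z := by
  cases p <;> simp only [src, Prod.mk.injEq] at h
  · exact Or.inl ⟨Subtype.ext h.2, by rw [← hx, P.mem_iff]; exact ⟨_, h.1.symm⟩⟩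
  · exact Or.inr ⟨Subtype.ext h.2, by rw [← hx, Q.mem_iff]; exact ⟨_, h.1.symm⟩⟩
  · exact Or.inl ⟨Subtype.ext h.2, by rw [← hx, P.mem_iff]; exact ⟨_, h.1.symm⟩⟩

theorem isMarked_tgt (p : Seg) {z : Annulus} {x : ℝ} (hx : (x : UnitAddCircle) = z.1)
    (h : (x, (z.2 : ℝ)) = tgt P Q p) : IsMarked A B z := by
  cases p <;> simp only [tgt, Prod.mk.injEq] at h
  · exact Or.inl ⟨Subtype.ext h.2, by rw [← hx, P.mem_iff]; exact ⟨_, h.1.symm⟩⟩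
  · exact Or.inr ⟨Subtype.ext h.2, by rw [← hx, Q.mem_iff]; exact ⟨_, h.1.symm⟩⟩
  · exact Or.inr ⟨Subtype.ext h.2, by rw [← hx, Q.mem_iff]; exact ⟨_, h.1.symm⟩⟩

/-- A horizontal extent of at most one turn gives an injective projection to the circle away from
the ends. The case of a full turn is that of loops. -/
theorem eq_of_coe_eq {x l : ℝ} (h0 : 0 < l) (h1 : l ≤ 1) {s t : I} (hs : s ∈ Set.Ioo (0 : I) 1)
    (ht : t ∈ Set.Ioo (0 : I) 1)
    (h : ((x + s * l : ℝ) : UnitAddCircle) = ((x + t * l : ℝ) : UnitAddCircle)) : s = t := by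
  obtain ⟨k, hk⟩ := coe_eq_coe_iff_exists_int.1 h
  have hs0 : (0 : ℝ) < s := hs.1
  have hs1 : (s : ℝ) < 1 := hs.2
  have ht0 : (0 : ℝ) < t := ht.1
  have ht1 : (t : ℝ) < 1 := ht.2
  have h2 : (k : ℝ) < 1 := by nlinarith
  have h3 : (-1 : ℝ) < k := by nlinarith
  have h2' : k < 1 := by exact_mod_cast h2
  have h3' : -1 < k := by exact_mod_cast h3
  obtain rfl : k = 0 := by omega
  simp only [Int.cast_zero, add_zero, add_right_inj] at hk
  exact Subtype.ext (mul_right_cancel₀ h0.ne' hk)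

theorem isArcCurve_stdCurve {φ : C(I, I)} (φ0 : φ 0 = 0) (φ1 : φ 1 = 1) {p : Seg}
    (hp : Adm n m p) : IsArcCurve A B (stdCurve P Q φ p) where
  marked_zero := by
    obtain ⟨g, hg, h0, -⟩ := directs_stdCurve (P := P) (Q := Q) φ0 φ1 hp
    exact isMarked_src p (hg 0) h0
  marked_one := by
    obtain ⟨g, hg, -, h1⟩ := directs_stdCurve (P := P) (Q := Q) φ0 φ1 hp
    exact isMarked_tgt p (hg 1) h1
  interior s hs hb := by
    have hb' : (stdHeight P Q p s : ℝ) = 0 ∨ (stdHeight P Q p s : ℝ) = 1 :=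
      hb.imp (fun h => congrArg Subtype.val h) (fun h => congrArg Subtype.val h)
    cases p with
    | outer a b =>
      obtain ⟨h0, h1⟩ := outer_width (P := P) hp
      have h2 := bump_mem h0 h1 s
      have h3 := bump_pos h0 hs
      rw [stdHeight_outer hp] at hb'
      rcases hb' with h | h <;> linarith
    | inner a b =>
      obtain ⟨h0, h1⟩ := inner_width (Q := Q) hp
      have h2 := bump_mem h0 h1 s
      have h3 := bump_pos h0 hs
      rw [stdHeight_inner hp] at hb'
      rcases hb' with h | h <;> linarith
    | bridge a b =>
      have hs0 : (0 : ℝ) < s := hs.1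
      have hs1 : (s : ℝ) < 1 := hs.2
      simp only [stdHeight, ContinuousMap.coe_mk, coe_symm_eq] at hb'
      rcases hb' with h | h <;> linarith
  simple s hs t ht e := by
    have e1 : (stdLift P Q φ p s : UnitAddCircle) = stdLift P Q φ p t := congrArg Prod.fst e
    have e2 : stdHeight P Q p s = stdHeight P Q p t := congrArg Prod.snd e
    cases p with
    | outer a b =>
      obtain ⟨h0, h1⟩ := outer_width (P := P) hp
      exact eq_of_coe_eq h0 h1 hs ht e1
    | inner a b =>
      obtain ⟨h0, h1⟩ := inner_width (Q := Q) hp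
      exact eq_of_coe_eq h0 h1 hs ht e1
    | bridge a b => exact symm_bijective.injective e2
  essential := (directs_stdCurve φ0 φ1 hp).not_isBoundaryParallel hp

/-- A crossing curve that runs vertically near the boundary. -/
noncomputable def bent : C(I, I) :=
  ⟨fun s => Set.projIcc 0 1 zero_le_one (2 * s - 1 / 2 : ℝ), continuous_projIcc.comp (by fun_prop)⟩

theorem bent_of_le {s : I} (hs : (s : ℝ) ≤ 1 / 4) : bent s = 0 :=
  Set.projIcc_of_le_left zero_le_one (by linarith)

theorem bent_of_ge {s : I} (hs : 3 / 4 ≤ (s : ℝ)) : bent s = 1 :=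
  Set.projIcc_of_right_le zero_le_one (by linarith)

theorem bent_zero : bent 0 = 0 := bent_of_le (by simp)

theorem bent_one : bent 1 = 1 := bent_of_ge (by norm_num)

/-- Nested parabolic arcs do not meet. -/
theorem bump_ne {a b c d x : ℝ} {s t : I} (hs : s ∈ Set.Ioo (0 : I) 1)
    (ht : t ∈ Set.Ioo (0 : I) 1) (hab : a < b) (hcd : c < d) (hx : x = a + s * (b - a))
    (hy : x = c + t * (d - c)) (hne : ¬ (a = c ∧ b = d))
    (h₁ : ¬ (a < c ∧ c < b ∧ b < d)) (h₂ : ¬ (c < a ∧ a < d ∧ d < b)) :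
    (s : ℝ) * (1 - s) * (b - a) ^ 2 ≠ t * (1 - t) * (d - c) ^ 2 := by
  have hs0 : (0 : ℝ) < s := hs.1
  have hs1 : (s : ℝ) < 1 := hs.2
  have ht0 : (0 : ℝ) < t := ht.1
  have ht1 : (t : ℝ) < 1 := ht.2
  have e1 : (s : ℝ) * (1 - s) * (b - a) ^ 2 = (x - a) * (b - x) := by rw [hx]; ring
  have e2 : (t : ℝ) * (1 - t) * (d - c) ^ 2 = (x - c) * (d - x) := by rw [hy]; ring
  have xa : a < x := by nlinarith
  have xb : x < b := by nlinarith
  have xc : c < x := by nlinarith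
  have xd : x < d := by nlinarith
  rw [e1, e2]
  intro h
  rcases lt_trichotomy a c with h3 | h3 | h3
  · have h4 : d ≤ b := by
      by_contra! h4
      exact h₁ ⟨h3, by linarith, h4⟩
    nlinarith
  · refine hne ⟨h3, ?_⟩
    subst h3
    have := mul_left_cancel₀ (sub_pos.2 xa).ne' h
    linarith
  · have h4 : b ≤ d := by
      by_contra! h4
      exact h₂ ⟨h3, by linarith, h4⟩
    nlinarith

/-- The parabola has depth at most `1 / 4`, and a bent bridge is vertical at heights of at least `3
/ 4`. They can meet only if the outer end of the bridge lies strictly under the parabola. -/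
theorem stdCurve_ne_outer_bridge {a b c d : ℤ} (hp : Adm n m (outer a b))
    (hc : ¬ (a < c ∧ c < b)) {s t : I} (hs : s ∈ Set.Ioo (0 : I) 1)
    (e1 : stdLift P Q bent (outer a b) s = stdLift P Q bent (bridge c d) t)
    (e2 : stdHeight P Q (outer a b) s = stdHeight P Q (bridge c d) t) : False := by
  obtain ⟨h0, h1⟩ := outer_width (P := P) hp
  have hs0 : (0 : ℝ) < s := hs.1
  have hs1 : (s : ℝ) < 1 := hs.2
  have h2 := bump_mem h0 h1 s
  have e2' : (stdHeight P Q (outer a b) s : ℝ) = 1 - t := congrArg Subtype.val e2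
  rw [stdHeight_outer hp] at e2'
  have e1' : P.pt a + s * (P.pt b - P.pt a) = P.pt c + bent t * (Q.pt d - P.pt c) := e1
  rw [bent_of_le (by linarith), Set.Icc.coe_zero, zero_mul, add_zero] at e1'
  refine hc ⟨P.mono.lt_iff_lt.1 ?_, P.mono.lt_iff_lt.1 ?_⟩ <;> nlinarith

theorem stdCurve_ne_inner_bridge {a b c d : ℤ} (hp : Adm n m (inner a b))
    (hc : ¬ (a < d ∧ d < b)) {s t : I} (hs : s ∈ Set.Ioo (0 : I) 1)
    (e1 : stdLift P Q bent (inner a b) s = stdLift P Q bent (bridge c d) t)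
    (e2 : stdHeight P Q (inner a b) s = stdHeight P Q (bridge c d) t) : False := by
  obtain ⟨h0, h1⟩ := inner_width (Q := Q) hp
  have hs0 : (0 : ℝ) < s := hs.1
  have hs1 : (s : ℝ) < 1 := hs.2
  have h2 := bump_mem h0 h1 s
  have e2' : (stdHeight P Q (inner a b) s : ℝ) = 1 - t := congrArg Subtype.val e2
  rw [stdHeight_inner hp] at e2'
  have e1' : Q.pt a + s * (Q.pt b - Q.pt a) = P.pt c + bent t * (Q.pt d - P.pt c) := e1
  rw [bent_of_ge (by linarith), Set.Icc.coe_one, one_mul] at e1'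
  refine hc ⟨Q.mono.lt_iff_lt.1 ?_, Q.mono.lt_iff_lt.1 ?_⟩ <;> nlinarith

theorem stdHeight_ne_outer_inner {a b c d : ℤ} (hp : Adm n m (outer a b))
    (hq : Adm n m (inner c d)) (s t : I) :
    stdHeight P Q (outer a b) s ≠ stdHeight P Q (inner c d) t := by
  intro e
  obtain ⟨h0, h1⟩ := outer_width (P := P) hp
  obtain ⟨k0, k1⟩ := inner_width (Q := Q) hq
  have h2 := bump_mem h0 h1 s
  have k2 := bump_mem k0 k1 t
  have e' := congrArg Subtype.val e
  rw [stdHeight_outer hp, stdHeight_inner hq] at e'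
  linarith

/-- At a common height, the horizontal position is a strictly positive combination of the two ends,
hence strictly monotone in each. Bent bridges would overlap near a common endpoint, which is why two
bridges are drawn straight. -/
theorem stdCurve_ne_bridge_bridge {a b c d : ℤ} (hc : ¬ Cross (bridge a b) (bridge c d))
    (hne : bridge a b ≠ bridge c d) {s t : I} (hs : s ∈ Set.Ioo (0 : I) 1)
    (e1 : stdLift P Q (ContinuousMap.id I) (bridge a b) s =
      stdLift P Q (ContinuousMap.id I) (bridge c d) t)
    (e2 : stdHeight P Q (bridge a b) s = stdHeight P Q (bridge c d) t) : False := by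
  obtain rfl : s = t := symm_bijective.injective e2
  have hs0 : (0 : ℝ) < s := hs.1
  have hs1 : (s : ℝ) < 1 := hs.2
  have e : P.pt a + s * (Q.pt b - P.pt a) = P.pt c + s * (Q.pt d - P.pt c) := e1
  simp only [Cross] at hc
  have key : ∀ {a b c d : ℤ}, P.pt a + s * (Q.pt b - P.pt a) = P.pt c + s * (Q.pt d - P.pt c) →
      a ≤ c → b ≤ d → a = c ∧ b = d := by
    intro a b c d e hac hbd
    have h1 := P.mono.monotone hac
    have h2 := Q.mono.monotone hbd
    constructor
    · refine P.mono.injective (le_antisymm h1 ?_)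
      by_contra! h
      nlinarith
    · refine Q.mono.injective (le_antisymm h2 ?_)
      by_contra! h
      nlinarith
  by_cases h : a ≤ c ∧ b ≤ d
  · obtain ⟨rfl, rfl⟩ := key e h.1 h.2
    exact hne rfl
  · obtain ⟨rfl, rfl⟩ := key e.symm (by omega : c ≤ a) (by omega)
    exact hne rfl

/-- The shape of the standard curves that separates two noncrossing segments. -/
noncomputable def shape : Seg → Seg → C(I, I)
  | bridge _ _, bridge _ _ => ContinuousMap.id I
  | _, _ => bent

theorem shape_zero (p q : Seg) : shape p q 0 = 0 := by
  cases p <;> cases q <;> simp [shape, bent_zero]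

theorem shape_one (p q : Seg) : shape p q 1 = 1 := by
  cases p <;> cases q <;> simp [shape, bent_one]

/-- The standard curves of noncrossing segments do not meet in the universal cover. -/
theorem stdCurve_lift_ne {p q : Seg} (hp : Adm n m p) (hq : Adm n m q)
    (hc : ¬ Cross p q) (hpq : p ≠ q) {s t : I} (hs : s ∈ Set.Ioo (0 : I) 1)
    (ht : t ∈ Set.Ioo (0 : I) 1)
    (e1 : stdLift P Q (shape p q) p s = stdLift P Q (shape p q) q t)
    (e2 : stdHeight P Q p s = stdHeight P Q q t) : False := by
  rcases p with ⟨a, b⟩ | ⟨a, b⟩ | ⟨a, b⟩ <;> rcases q with ⟨c, d⟩ | ⟨c, d⟩ | ⟨c, d⟩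
  · obtain ⟨h0, -⟩ := outer_width (P := P) hp
    obtain ⟨k0, -⟩ := outer_width (P := P) hq
    simp only [Cross, ChordCross, not_or] at hc
    have e2' := congrArg Subtype.val e2
    rw [stdHeight_outer hp, stdHeight_outer hq] at e2'
    refine bump_ne hs ht (sub_pos.1 h0) (sub_pos.1 k0) rfl e1 ?_ ?_ ?_
      (by linarith) <;>
      simp only [P.mono.lt_iff_lt, P.mono.injective.eq_iff]
    · rintro ⟨rfl, rfl⟩
      exact hpq rfl
    · exact hc.1
    · exact hc.2
  · exact stdHeight_ne_outer_inner hp hq s t e2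
  · exact stdCurve_ne_outer_bridge hp hc hs e1 e2
  · exact stdHeight_ne_outer_inner hq hp t s e2.symm
  · obtain ⟨h0, -⟩ := inner_width (Q := Q) hp
    obtain ⟨k0, -⟩ := inner_width (Q := Q) hq
    simp only [Cross, ChordCross, not_or] at hc
    have e2' := congrArg Subtype.val e2
    rw [stdHeight_inner hp, stdHeight_inner hq] at e2'
    refine bump_ne hs ht (sub_pos.1 h0) (sub_pos.1 k0) rfl e1 ?_ ?_ ?_
      (by linarith) <;>
      simp only [Q.mono.lt_iff_lt, Q.mono.injective.eq_iff]
    · rintro ⟨rfl, rfl⟩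
      exact hpq rfl
    · exact hc.1
    · exact hc.2
  · exact stdCurve_ne_inner_bridge hp hc hs e1 e2
  · exact stdCurve_ne_outer_bridge hq hc ht e1.symm e2.symm
  · exact stdCurve_ne_inner_bridge hq hc ht e1.symm e2.symm
  · exact stdCurve_ne_bridge_bridge hc hpq hs e1 e2

theorem stdLift_shift (φ : C(I, I)) (k : ℤ) (p : Seg) (s : I) :
    stdLift P Q φ (shift n m k p) s = stdLift P Q φ p s + k := by
  cases p <;> simp only [stdLift, shift, ContinuousMap.coe_mk, Enum.add_mul] <;> ring

theorem stdHeight_shift (k : ℤ) (p : Seg) (s : I) :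
    stdHeight P Q (shift n m k p) s = stdHeight P Q p s := by
  cases p <;> simp [stdHeight, shift, Enum.add_mul]

theorem shape_shift (k : ℤ) (p q : Seg) : shape p (shift n m k q) = shape p q := by
  cases p <;> cases q <;> rfl

/-- The standard curves of noncrossing arcs do not meet. -/
theorem stdCurve_ne {p q : Seg} (hp : Adm n m p) (hq : Adm n m q) (hc : ¬ PeriodicCross n m p q)
    (hpq : ∀ k, p ≠ shift n m k q) {s t : I} (hs : s ∈ Set.Ioo (0 : I) 1)
    (ht : t ∈ Set.Ioo (0 : I) 1) :
    stdCurve P Q (shape p q) p s ≠ stdCurve P Q (shape p q) q t := by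
  intro e
  have e1 : (stdLift P Q (shape p q) p s : UnitAddCircle) = stdLift P Q (shape p q) q t :=
    congrArg Prod.fst e
  have e2 : stdHeight P Q p s = stdHeight P Q q t := congrArg Prod.snd e
  obtain ⟨k, hk⟩ := coe_eq_coe_iff_exists_int.1 e1
  refine stdCurve_lift_ne (P := P) (Q := Q) hp ((adm_shift n m k q).2 hq) (fun h => hc ⟨k, h⟩)
    (hpq k) hs ht ?_ ?_
  · rw [shape_shift, stdLift_shift, hk]
  · rw [stdHeight_shift, e2]

end Seg

end Annulus

/-! ### Topological and combinatorial triangulations agree -/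

namespace Annulus

open unitInterval

theorem NonCrossing.symm {A B : Finset UnitAddCircle} {a b : Arc A B} (h : NonCrossing a b) :
    NonCrossing b a := by
  obtain ⟨γ, δ, h1, h2, h⟩ := h
  exact ⟨δ, γ, h2, h1, fun s hs t ht e => h t ht s hs e.symm⟩

theorem isTriangulation_iff {A B : Finset UnitAddCircle} {T : Set (Arc A B)} :
    IsTriangulation T ↔ ∀ a, a ∈ T ↔ ∀ b ∈ T, a ≠ b → NonCrossing a b := by
  constructor
  · intro hT a
    refine ⟨fun ha b hb hab => hT.prop ha hb hab, fun h => ?_⟩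
    have hins : (insert a T).Pairwise NonCrossing :=
      hT.prop.insert fun b hb hab => ⟨h b hb hab, (h b hb hab).symm⟩
    exact hT.le_of_ge hins (Set.subset_insert a T) (Set.mem_insert a T)
  · intro h
    refine ⟨fun a ha b hb hab => (h a).1 ha b hb hab, fun S hS hTS a ha => ?_⟩
    exact (h a).2 fun b hb hab => hS ha (hTS hb) hab

namespace Seg

variable {A B : Finset UnitAddCircle} {n m : ℤ} (P : Enum A n) (Q : Enum B m)

/-- The arc with a given lift. -/
noncomputable def arcOf (p : {p // Adm n m p}) : Arc A B :=
  ArcCurve.toArc ⟨stdCurve P Q bent p.1,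
    isArcCurve_stdCurve bent_zero bent_one p.2⟩

theorem toArc_eq_arcOf {γ : ArcCurve A B} {p : Seg} (hp : Adm n m p)
    (h : Represents P Q γ.1 p) : γ.toArc = arcOf P Q ⟨p, hp⟩ :=
  Quotient.sound (h.sameArc
    (Or.inl (directs_stdCurve bent_zero bent_one hp)))

theorem represents_of_toArc_eq {γ : ArcCurve A B} {p : {p // Adm n m p}}
    (h : γ.toArc = arcOf P Q p) : Represents P Q γ.1 p.1 := by
  refine Represents.of_sameArc (Or.inl (directs_stdCurve bent_zero
    bent_one p.2)) (sameArc_equivalence.symm (Quotient.exact h))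

theorem arcOf_surjective (hn : 1 ≤ n) (hm : 1 ≤ m) : Function.Surjective (arcOf P Q) := by
  intro a
  induction a using Quotient.inductionOn with
  | h γ =>
    obtain ⟨p, hp, h⟩ := exists_represents (P := P) (Q := Q) hn hm γ.2
    exact ⟨⟨p, hp⟩, (toArc_eq_arcOf P Q hp h).symm⟩

theorem exists_toArc_eq (p : {p // Adm n m p}) : ∃ γ : ArcCurve A B, γ.toArc = arcOf P Q p :=
  ⟨_, rfl⟩

theorem arcOf_eq_iff {p q : {p // Adm n m p}} :
    arcOf P Q p = arcOf P Q q ↔ ∃ k, q.1 = shift n m k p.1 := by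
  obtain ⟨γ, hγ⟩ := exists_toArc_eq P Q p
  constructor
  · intro h
    exact (represents_of_toArc_eq P Q hγ).eq_shift (represents_of_toArc_eq P Q (hγ.trans h)) p.2 q.2
  · rintro ⟨k, hk⟩
    have := (represents_of_toArc_eq P Q hγ).shift k
    rw [← hk] at this
    rw [← hγ, toArc_eq_arcOf P Q q.2 this]

/-- Crossing lifts force all representatives to meet. Otherwise the standard curves are disjoint;
their shape may depend on the pair, because noncrossing is a condition on one pair of arcs at a
time. -/
theorem nonCrossing_arcOf_iff {p q : {p // Adm n m p}} (hpq : arcOf P Q p ≠ arcOf P Q q) :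
    NonCrossing (arcOf P Q p) (arcOf P Q q) ↔ ¬ PeriodicCross n m p.1 q.1 := by
  constructor
  · rintro ⟨γ, δ, hγ, hδ, h⟩ hc
    obtain ⟨s, hs, t, ht, e⟩ := Represents.exists_meet γ.2 δ.2 (represents_of_toArc_eq P Q hγ)
      (represents_of_toArc_eq P Q hδ) hc
    exact h s hs t ht e
  · intro hc
    have h0 := shape_zero p.1 q.1
    have h1 := shape_one p.1 q.1
    refine ⟨⟨_, isArcCurve_stdCurve (P := P) (Q := Q) h0 h1 p.2⟩,
      ⟨_, isArcCurve_stdCurve (P := P) (Q := Q) h0 h1 q.2⟩,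
      toArc_eq_arcOf P Q p.2 (Or.inl (directs_stdCurve h0 h1 p.2)),
      toArc_eq_arcOf P Q q.2 (Or.inl (directs_stdCurve h0 h1 q.2)),
      fun s hs t ht => stdCurve_ne p.2 q.2 hc (fun k hk => hpq ?_) hs ht⟩
    exact ((arcOf_eq_iff P Q).2 ⟨k, hk⟩).symm

theorem twist_arcOf (p : {p // Adm n m p}) :
    Arc.twist A B (arcOf P Q p) = arcOf P Q ⟨twist m 1 p.1, (adm_twist n m 1 p.1).2 p.2⟩ := by
  obtain ⟨γ, hγ⟩ := exists_toArc_eq P Q p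
  have h := (represents_of_toArc_eq P Q hγ).map_dehnTwist
  rw [← hγ]
  exact toArc_eq_arcOf P Q (γ := γ.map dehnTwist fixesBoundary_dehnTwist) _ h

theorem zpow_twist_arcOf (k : ℤ) (p : {p // Adm n m p}) :
    (Arc.twist A B ^ k) (arcOf P Q p) =
      arcOf P Q ⟨twist m k p.1, (adm_twist n m k p.1).2 p.2⟩ := by
  induction k using Int.induction_on generalizing p with
  | zero => simp [twist_zero]
  | succ k ih =>
    rw [zpow_add_one, Equiv.Perm.mul_apply, twist_arcOf, ih]
    simp only [twist_twist, add_comm]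
  | pred k ih =>
    have h : (Arc.twist A B)⁻¹ (arcOf P Q p) =
        arcOf P Q ⟨twist m (-1) p.1, (adm_twist n m (-1) p.1).2 p.2⟩ := by
      rw [Equiv.Perm.inv_eq_iff_eq, twist_arcOf]
      simp only [twist_twist, neg_add_cancel, twist_zero]
    rw [zpow_sub_one, Equiv.Perm.mul_apply, h, ih]
    simp only [twist_twist]
    congr 3
    ring

/-- The lifts of the arcs in a set. -/
def liftSet (T : Set (Arc A B)) : Set Seg := {p | ∃ hp : Adm n m p, arcOf P Q ⟨p, hp⟩ ∈ T}

/-- The topological condition ignores pairs of equal arcs and the combinatorial one does not.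
`adm_not_cross` removes this difference. -/
theorem isFacet_liftSet {T : Set (Arc A B)} (hn : 1 ≤ n) (hm : 1 ≤ m) :
    IsFacet {p | Adm n m p} (PeriodicCross n m) (liftSet P Q T) ↔ IsTriangulation T := by
  have key : ∀ p : {p // Adm n m p}, (∀ b ∈ T, arcOf P Q p ≠ b → NonCrossing (arcOf P Q p) b) ↔
      ∀ q ∈ liftSet P Q T, ¬ PeriodicCross n m p.1 q := by
    intro p
    constructor
    · rintro h q ⟨hq, hqT⟩ hc
      by_cases e : arcOf P Q p = arcOf P Q ⟨q, hq⟩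
      · obtain ⟨k, hk⟩ := (arcOf_eq_iff P Q).1 e
        dsimp only at hk
        rw [hk, periodicCross_comm, periodicCross_shift_left] at hc
        exact adm_not_cross hn hm p.2 hc
      · exact (nonCrossing_arcOf_iff P Q e).1 (h _ hqT e) hc
    · intro h b hb e
      obtain ⟨q, rfl⟩ := arcOf_surjective P Q hn hm b
      exact (nonCrossing_arcOf_iff P Q e).2 (h q.1 ⟨q.2, hb⟩)
  rw [isTriangulation_iff]
  constructor
  · intro h a
    obtain ⟨p, rfl⟩ := arcOf_surjective P Q hn hm a
    rw [key p]
    have := h p.1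
    constructor
    · intro hp
      exact (this.1 ⟨p.2, hp⟩).2
    · intro hp
      exact (this.2 ⟨p.2, hp⟩).2
  · intro h p
    constructor
    · rintro ⟨hp, hpT⟩
      exact ⟨hp, (key ⟨p, hp⟩).1 ((h _).1 hpT)⟩
    · rintro ⟨hp, hpc⟩
      exact ⟨hp, (h _).2 ((key ⟨p, hp⟩).2 hpc)⟩

theorem liftSet_image {F : Tri n m} : liftSet P Q {a | ∃ p, p.1 ∈ F.1 ∧ arcOf P Q p = a} = F.1 := by
  ext p
  constructor
  · rintro ⟨hp, q, hq, e⟩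
    obtain ⟨k, hk⟩ := (arcOf_eq_iff P Q).1 e
    dsimp only at hk
    rw [hk]
    exact F.shift_mem k hq
  · intro hp
    exact ⟨((F.2 p).1 hp).1, ⟨p, ((F.2 p).1 hp).1⟩, hp, rfl⟩

theorem liftSet_injective (hn : 1 ≤ n) (hm : 1 ≤ m) {T T' : Set (Arc A B)}
    (h : liftSet P Q T = liftSet P Q T') : T = T' := by
  ext a
  obtain ⟨p, rfl⟩ := arcOf_surjective P Q hn hm a
  have := Set.ext_iff.1 h p.1
  constructor
  · intro hp
    exact (this.1 ⟨p.2, hp⟩).2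
  · intro hp
    exact (this.2 ⟨p.2, hp⟩).2

/-- Triangulations of the annulus are combinatorial triangulations. -/
noncomputable def triangulationEquiv (hn : 1 ≤ n) (hm : 1 ≤ m) : Triangulation A B ≃ Tri n m :=
  Equiv.ofBijective (fun T => ⟨liftSet P Q T.1, (isFacet_liftSet P Q hn hm).2 T.2⟩) <| by
    constructor
    · intro T T' h
      exact Subtype.ext (liftSet_injective P Q hn hm (congrArg Subtype.val h))
    · intro F
      refine ⟨⟨{a | ∃ p, p.1 ∈ F.1 ∧ arcOf P Q p = a}, ?_⟩, Subtype.ext (liftSet_image P Q)⟩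
      rw [← isFacet_liftSet P Q hn hm, liftSet_image]
      exact F.2

theorem liftSet_image_twist (T : Set (Arc A B)) (k : ℤ) :
    liftSet P Q ((Arc.twist A B ^ k) '' T) = {p | twist m (-k) p ∈ liftSet P Q T} := by
  ext p
  have h : ∀ hp : Adm n m p, arcOf P Q ⟨p, hp⟩ ∈ (Arc.twist A B ^ k) '' T ↔
      arcOf P Q ⟨twist m (-k) p, (adm_twist n m (-k) p).2 hp⟩ ∈ T := by
    intro hp
    rw [← zpow_twist_arcOf P Q (-k) ⟨p, hp⟩, zpow_neg, Set.mem_image_equiv]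
    rfl
  constructor
  · rintro ⟨hp, h'⟩
    exact ⟨_, (h hp).1 h'⟩
  · rintro ⟨hp, h'⟩
    exact ⟨(adm_twist n m (-k) p).1 hp, (h _).2 h'⟩

theorem innerEquivalent_iff (hn : 1 ≤ n) (hm : 1 ≤ m) (T T' : Triangulation A B) :
    InnerEquivalent T T' ↔
      ∃ k, (triangulationEquiv P Q hn hm T).twist k = triangulationEquiv P Q hn hm T' := by
  -- The sign changes because `Tri.twist` takes the preimage under `k` twists, not the image.
  have h : ∀ k : ℤ, (Arc.twist A B ^ k) '' T.1 = T'.1 ↔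
      (triangulationEquiv P Q hn hm T).twist (-k) = triangulationEquiv P Q hn hm T' := by
    intro k
    rw [Subtype.ext_iff]
    change _ ↔ {p | twist m (-k) p ∈ liftSet P Q T.1} = liftSet P Q T'.1
    rw [← liftSet_image_twist]
    exact ⟨fun e => congrArg _ e, liftSet_injective P Q hn hm⟩
  constructor
  · rintro ⟨k, hk⟩
    exact ⟨-k, (h k).1 hk⟩
  · rintro ⟨k, hk⟩
    exact ⟨-k, (h (-k)).2 (by rwa [neg_neg])⟩

end Seg

/-- The lifts of a finite nonempty subset of the circle can be enumerated in increasing order. -/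
theorem exists_enum (n : ℕ) (hn : 1 ≤ n) (A : Finset UnitAddCircle) (hA : A.card = n) :
    Nonempty (Enum A n) := by
  have hn' : (0 : ℤ) < n := by omega
  let f : UnitAddCircle → ℝ := fun x => (AddCircle.equivIco 1 0 x : ℝ)
  have hf : ∀ x, (f x : UnitAddCircle) = x := fun x => (AddCircle.equivIco 1 0).symm_apply_apply x
  have hf01 : ∀ x, 0 ≤ f x ∧ f x < 1 := fun x => by
    obtain ⟨h0, h1⟩ := (AddCircle.equivIco 1 0 x).2
    exact ⟨h0, h1.trans_eq (zero_add 1)⟩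
  have hinj : Function.Injective f := fun x y h => by rw [← hf x, h, hf y]
  let s := (A.image f).orderEmbOfFin ((Finset.card_image_of_injective A hinj).trans hA)
  have hs : ∀ i, 0 ≤ s i ∧ s i < 1 ∧ (s i : UnitAddCircle) ∈ A := by
    intro i
    obtain ⟨x, hx, e⟩ := Finset.mem_image.1
      ((A.image f).orderEmbOfFin_mem ((Finset.card_image_of_injective A hinj).trans hA) i)
    have e : f x = s i := e
    rw [← e]
    exact ⟨(hf01 x).1, (hf01 x).2, by rwa [hf]⟩
  have hmod : ∀ j : ℤ, (j % n).toNat < n := fun j => by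
    have := Int.emod_lt_of_pos j hn'
    omega
  -- The representatives in `[0, 1)`, listed increasingly, are repeated with period `1`. After the
  -- last one, the list continues with the first one of the next unit interval.
  let pt : ℤ → ℝ := fun j => s ⟨(j % n).toNat, hmod j⟩ + ((j / n : ℤ) : ℝ)
  have hpt : ∀ (i : Fin n) (k : ℤ), pt (i + n * k) = s i + k := by
    intro i k
    have h1 : ((i : ℤ) + n * k) / n = k := by
      rw [Int.add_mul_ediv_left _ _ hn'.ne', Int.ediv_eq_zero_of_lt (by omega) (by omega), zero_add]
    have h2 : ((i : ℤ) + n * k) % n = i := by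
      rw [Int.add_mul_emod_self_left, Int.emod_eq_of_lt (by omega) (by omega)]
    simp only [pt, h1, h2, Int.toNat_natCast, Fin.eta]
  have hdec : ∀ j : ℤ, ∃ (i : Fin n) (k : ℤ), j = i + n * k := fun j =>
    ⟨⟨(j % n).toNat, hmod j⟩, j / n, by
      have h1 := Int.emod_add_mul_ediv j n
      have h2 := Int.emod_nonneg j hn'.ne'
      simp only
      omega⟩
  refine ⟨⟨pt, strictMono_int_of_lt_succ fun j => ?_, fun j => ?_, fun x => ⟨fun hx => ?_, ?_⟩⟩⟩
  · obtain ⟨i, k, rfl⟩ := hdec j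
    rw [hpt]
    by_cases hi : (i : ℕ) + 1 < n
    · have := hpt ⟨i + 1, hi⟩ k
      rw [show (i : ℤ) + n * k + 1 = ((⟨i + 1, hi⟩ : Fin n) : ℕ) + n * k by push_cast; ring, this]
      have : s i < s ⟨i + 1, hi⟩ := s.strictMono (Fin.lt_def.2 (by simp))
      linarith
    · have := hpt ⟨0, hn⟩ (k + 1)
      have hi' : (i : ℤ) + 1 = n := by omega
      rw [show (i : ℤ) + n * k + 1 = ((⟨0, hn⟩ : Fin n) : ℕ) + n * (k + 1) by
        push_cast; linarith, this]
      have h1 := (hs i).2.1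
      have h2 := (hs ⟨0, hn⟩).1
      push_cast
      linarith
  · obtain ⟨i, k, rfl⟩ := hdec j
    rw [show (i : ℤ) + n * k + n = i + n * (k + 1) by ring, hpt, hpt]
    push_cast
    ring
  · have hx' : f x ∈ A.image f := Finset.mem_image_of_mem f hx
    have : f x ∈ Set.range s := by
      rw [Finset.range_orderEmbOfFin]
      exact hx'
    obtain ⟨i, hi⟩ := this
    obtain ⟨k, hk⟩ := coe_eq_coe_iff_exists_int.1 (hf x).symm
    exact ⟨i + n * k, by rw [hpt, hi, ← hk]⟩
  · rintro ⟨j, rfl⟩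
    obtain ⟨i, k, rfl⟩ := hdec j
    rw [hpt, coe_eq_coe_iff_exists_int.2 ⟨k, rfl⟩]
    exact (hs i).2.2

end Annulus

theorem theorem3p1 (n m : ℕ) (hn : 1 ≤ n) (hm : 1 ≤ m) (A B : Finset UnitAddCircle)
    (hA : A.card = n) (hB : B.card = m) :
    Nat.card (Annulus.Family A B) =
      n * ∑ i ∈ Finset.range m, (i + 1) * catalan i * catalan (n + m - i - 1) := by
  obtain ⟨P⟩ := Annulus.exists_enum n hn A hA
  obtain ⟨Q⟩ := Annulus.exists_enum m hm B hB
  have hn' : (1 : ℤ) ≤ n := by omega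
  have hm' : (1 : ℤ) ≤ m := by omega
  exact Annulus.Seg.card_quotient_tri hn hm (Annulus.Seg.triangulationEquiv P Q hn' hm')
    (Annulus.innerSetoid A B) (Annulus.Seg.innerEquivalent_iff P Q hn' hm')
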